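/- **Conventions.** Let $d\ge 0$. A *labeled Delone set* is the graph of a map $\ell:\Lambda\to X$ from a uniformly discrete and relatively dense set $\Lambda\subset\mathbb R^d$ to a compact metric space $X$. A *labeled tiling* is the graph of a map to $X$ from a set of tiles (convex polytopes with nonempty interior, belonging up to translation to a set of polytopes that is compact for the Hausdorff distance) that cover $\mathbb R^d$ and pairwise intersect only on their boundaries. $T\cap B(x,R)$ denotes the set of labeled points of $T$ in $B(x,R)$, respectively of labeled tiles of $T$ meeting $B(x,R)$. $T$ and $T'$ are $\varepsilon$-close if a one-to-one correspondence between some of their labeled points (tiles), including all those in (meeting) $B(0,1/\varepsilon)$, moves points (tiles, in Hausdorff distance) and labels by less than $\varepsilon$; this defines the topology. A *tiling space* $\Omega$ is the closure of the set of all translates $T-x$ ($x\in\mathbb R^d$) of a labeled Delone set or labeled tiling $T$; all tiling spaces are assumed minimal (every translation orbit is dense) and aperiodic ($T-x=T$ with $T\in\Omega$ only for $x=0$). $\Omega$ is *FLC* if, for each $R>0$, only finitely many patches $T\cap B(x,R)$, $T\in\Omega$, $x\in\mathbb R^d$, occur up to translation. An *orbit equivalence* $h:\Omega\to\Omega'$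 is a homeomorphism that sends $\mathbb R^d$-orbits onto $\mathbb R^d$-orbits. A *topological conjugacy* is a homeomorphism $\phi$ with $\phi(T-x)=\phi(T)-x$. A continuous map $f:\Omega\to\Omega'$ is *local* if for all $r>0$ there is $R>0$ such that $T\cap B(0,R)=T'\cap B(0,R)$ implies $f(T)\cap B(0,r)=f(T')\cap B(0,r)$. An *MLD map* is a topological conjugacy $\phi$ such that $\phi$ and $\phi^{-1}$ are local. A *weak cocycle* is a continuous $\alpha:\Omega\times\mathbb R^d\to\mathbb R^d$ with $\alpha(T,v)+\alpha(T-v,w)=\alpha(T,v+w)$. A continuous $s:\Omega\to\mathbb R^d$ has the coboundary $\delta s(T,v)=s(T-v)-s(T)$, and is *strongly pattern-equivariant* if for some $R>0$ the value $s(T)$ depends only on $T\cap B(0,R)$. A *strong cocycle* is a weak cocycle for which $T\mapsto\alpha(T,v)$ is strongly pattern-equivariant for every $v$. $H^1_w(\Omega;\mathbb R^d)$ is the group of weak cocycles modulo coboundaries of continuous functions, and $H^1_s(\Omega;\mathbb R^d)$ the group of strong cocycles modulo coboundaries of strongly pattern-equivariant functions. The cocycle of a map $h$ that sends orbits into orbits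 is $(T,x)\mapsto h_T(x)$, where $h(T-x)=h(T)-h_T(x)$. For an orbit equivalence $h$ it is a weak cocycle, and $[h]\in H^1_w(\Omega;\mathbb R^d)$ is its class. If $\Omega,\Omega'$ are FLC, then $[h]\in H^1_s(\Omega;\mathbb R^d)$ is the class of the cocycle of $h_s:T\mapsto h(T)-s(T)$, where $s:\Omega\to\mathbb R^d$ is any continuous function such that $h_s$ is a local map (such $s$ exist, the cocycle of $h_s$ is strong, and its class does not depend on $s$). **Theorem.** Let $h_1:\Omega\to\Omega_1$ and $h_2:\Omega\to\Omega_2$ be orbit equivalences between minimal aperiodic tiling spaces of $\mathbb R^d$. 1. If $[h_1]=[h_2]$ in $H^1_w(\Omega;\mathbb R^d)$, then there are a continuous $s:\Omega\to\mathbb R^d$ such that $\tau_s:\Omega\to\Omega$, $T\mapsto T-s(T)$, is a homeomorphism, and a topological conjugacy $\phi:\Omega_1\to\Omega_2$ such that $h_2\circ\tau_s=\phi\circ h_1$. 2. If $\Omega,\Omega_1,\Omega_2$ are FLC and $[h_1]=[h_2]$ in $H^1_s(\Omega;\mathbb R^d)$, then the same conclusion holds with $\phi$ an MLD map. -/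

import Mathlib

open Set Filter Topology TopologicalSpace Metric

noncomputable section

namespace TilingClassification

/-- The space `ℝ^d` with its Euclidean norm. -/
abbrev E (d : ℕ) : Type := EuclideanSpace ℝ (Fin d)

/-- A labeled tile: a nonempty compact subset of `ℝ^d` with a label. A labeled point `(x, l)` of a
Delone set is the labeled tile `({x}, l)`. The distance is the maximum of the Hausdorff distance
and of the distance between the labels; on labeled points it is `max ‖x - y‖ (dist l m)`. -/
abbrev Tile (d : ℕ) (X : Type*) : Type _ := NonemptyCompacts (E d) × X

/-- The translate `t - x` of a labeled tile. -/
def Tile.shift {d : ℕ} {X : Type*} (x : E d) (t : Tile d X) : Tile d X :=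
  (t.1.map (fun y => y - x) (continuous_id.sub continuous_const), t.2)

/-- A set of labeled tiles. Labeled tilings and labeled Delone sets are patterns. -/
@[ext]
structure Pattern (d : ℕ) (X : Type*) where
  tiles : Set (Tile d X)

namespace Pattern

variable {d : ℕ} {X : Type*}

/-- The translate `T - x`. -/
def shift (T : Pattern d X) (x : E d) : Pattern d X := ⟨Tile.shift x '' T.tiles⟩

/-- The patch `T ∩ B(x, R)`: the labeled tiles of `T` that meet the ball `B(x, R)`; for a Delone
set, the labeled points that lie in `B(x, R)`. -/
def patch (T : Pattern d X) (x : E d) (R : ℝ) : Pattern d X :=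
  ⟨{t ∈ T.tiles | ((t.1 : Set (E d)) ∩ ball x R).Nonempty}⟩

/-- The translation orbit of `T`. -/
def orbit (T : Pattern d X) : Set (Pattern d X) := range T.shift

/-- `T` is a labeled Delone set: the graph of a map from a Delone set to `X`. -/
def IsDelone (T : Pattern d X) : Prop :=
  ∃ (D : Delone.DeloneSet (E d)) (l : D.carrier → X),
    T.tiles = range fun x : D.carrier => (({(x : E d)} : NonemptyCompacts (E d)), l x)

/-- A tile shape: a convex polytope with nonempty interior. -/
def IsPolytope (t : NonemptyCompacts (E d)) : Prop :=
  (∃ F : Finset (E d), (t : Set (E d)) = convexHull ℝ (F : Set (E d))) ∧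
    (interior (t : Set (E d))).Nonempty

/-- `T` is a labeled tiling: up to translation its tiles belong to a compact set of polytopes,
they cover `ℝ^d`, and two distinct ones only intersect on their boundary. (In particular no tile
carries two labels.) -/
def IsTiling (T : Pattern d X) : Prop :=
  (∃ A : Set (NonemptyCompacts (E d)), IsCompact A ∧ (∀ a ∈ A, IsPolytope a) ∧
    ∀ t ∈ T.tiles, ∃ a ∈ A, ∃ x : E d, (t.1 : Set (E d)) = (fun y => y + x) '' (a : Set (E d))) ∧
  (⋃ t ∈ T.tiles, (t.1 : Set (E d))) = univ ∧
  ∀ t ∈ T.tiles, ∀ u ∈ T.tiles, t ≠ u →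
    (t.1 : Set (E d)) ∩ u.1 ⊆ frontier (t.1 : Set (E d)) ∩ frontier (u.1 : Set (E d))

/-- A family of patterns has finite local complexity: for each `R`, up to translation, only finitely
many patches of radius `R` occur in its members. -/
def HasFLC (S : Set (Pattern d X)) : Prop :=
  ∀ R : ℝ, 0 < R → ∃ F : Set (Pattern d X), F.Finite ∧
    ∀ T ∈ S, ∀ x : E d, ∃ P ∈ F, ∃ y : E d, T.patch x R = P.shift y

section Topology

variable [MetricSpace X]

/-- `T` and `T'` are `ε`-close: there is a one-to-one correspondence `M` between part of the tiles
of `T` and part of the tiles of `T'` such that corresponding tiles are at distance `< ε`, and such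
that all tiles of `T` and of `T'` that meet the ball `B(0, 1/ε)` take part in it. -/
def Close (ε : ℝ) (T T' : Pattern d X) : Prop :=
  ∃ M : Tile d X → Tile d X → Prop,
    (∀ t u, M t u → t ∈ T.tiles ∧ u ∈ T'.tiles ∧ dist t u < ε) ∧
    (∀ t u t' u', M t u → M t' u' → (t = t' ↔ u = u')) ∧
    (∀ t ∈ (T.patch 0 ε⁻¹).tiles, ∃ u, M t u) ∧
    (∀ u ∈ (T'.patch 0 ε⁻¹).tiles, ∃ t, M t u)

theorem Close.mono {ε δ : ℝ} (hε : 0 < ε) (h : ε ≤ δ) {T T' : Pattern d X} (H : Close ε T T') :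
    Close δ T T' := by
  obtain ⟨M, h1, h2, h3, h4⟩ := H
  have hb : ball (0 : E d) δ⁻¹ ⊆ ball 0 ε⁻¹ := ball_subset_ball (inv_anti₀ hε h)
  refine ⟨M, fun t u m => ?_, h2, fun t ht => h3 t ⟨ht.1, ht.2.mono (inter_subset_inter_right _ hb)⟩,
    fun t ht => h4 t ⟨ht.1, ht.2.mono (inter_subset_inter_right _ hb)⟩⟩
  obtain ⟨a, b, c⟩ := h1 t u m
  exact ⟨a, b, c.trans_le h⟩

theorem Close.refl {ε : ℝ} (hε : 0 < ε) (T : Pattern d X) : Close ε T T :=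
  ⟨fun t u => t ∈ T.tiles ∧ t = u,
    fun t u h => ⟨h.1, h.2 ▸ h.1, by rw [h.2, dist_self]; exact hε⟩,
    fun t u t' u' h h' => by rw [← h.2, ← h'.2],
    fun t ht => ⟨t, ht.1, rfl⟩, fun t ht => ⟨t, ht.1, rfl⟩⟩

theorem Close.symm {ε : ℝ} {T T' : Pattern d X} (H : Close ε T T') : Close ε T' T := by
  obtain ⟨M, h1, h2, h3, h4⟩ := H
  refine ⟨fun t u => M u t, fun t u m => ?_, fun t u t' u' m m' => (h2 _ _ _ _ m m').symm, h4, h3⟩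
  obtain ⟨a, b, c⟩ := h1 u t m
  exact ⟨b, a, by rwa [dist_comm]⟩

/-- A tile within `δ` of a tile that meets `B(0, r)` meets `B(0, r + δ)`. -/
theorem meets_of_dist_lt {t u : Tile d X} {r δ : ℝ} (h : dist t u < δ)
    (ht : ((t.1 : Set (E d)) ∩ ball 0 r).Nonempty) :
    ((u.1 : Set (E d)) ∩ ball 0 (r + δ)).Nonempty := by
  obtain ⟨y, hy, hyr⟩ := ht
  have h' : hausdorffDist (t.1 : Set (E d)) (u.1 : Set (E d)) < δ :=
    lt_of_le_of_lt (by rw [← NonemptyCompacts.dist_eq]; exact le_max_left _ _) h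
  obtain ⟨z, hz, hyz⟩ := exists_dist_lt_of_hausdorffDist_lt hy h'
    (hausdorffEDist_ne_top_of_nonempty_of_bounded t.1.nonempty u.1.nonempty
      t.1.isCompact.isBounded u.1.isCompact.isBounded)
  refine ⟨z, hz, ?_⟩
  rw [mem_ball] at hyr ⊢
  linarith [dist_triangle_left z 0 y]

theorem Close.trans {ε δ : ℝ} (hδ : 0 < δ) (h1 : δ ≤ ε / 2) (h2 : δ ≤ ε⁻¹)
    {T T' T'' : Pattern d X} (H : Close δ T T') (H' : Close δ T' T'') : Close ε T T'' := by
  have hε : 0 < ε := by linarith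
  have hr : ε⁻¹ + δ ≤ δ⁻¹ := by
    have : (ε / 2)⁻¹ ≤ δ⁻¹ := inv_anti₀ hδ h1
    have h3 : (ε / 2)⁻¹ = 2 * ε⁻¹ := by field_simp
    linarith
  have hb : ball (0 : E d) ε⁻¹ ⊆ ball 0 δ⁻¹ := ball_subset_ball (by linarith)
  have hb' : ball (0 : E d) (ε⁻¹ + δ) ⊆ ball 0 δ⁻¹ := ball_subset_ball hr
  obtain ⟨M, a1, a2, a3, a4⟩ := H
  obtain ⟨N, b1, b2, b3, b4⟩ := H'
  refine ⟨fun t v => ∃ u, M t u ∧ N u v, ?_, ?_, ?_, ?_⟩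
  · rintro t v ⟨u, m, n⟩
    obtain ⟨p1, p2, p3⟩ := a1 _ _ m
    obtain ⟨q1, q2, q3⟩ := b1 _ _ n
    exact ⟨p1, q2, by linarith [dist_triangle t u v]⟩
  · rintro t v t' v' ⟨u, m, n⟩ ⟨u', m', n'⟩
    rw [a2 _ _ _ _ m m', b2 _ _ _ _ n n']
  · rintro t ⟨ht, hm⟩
    obtain ⟨u, m⟩ := a3 t ⟨ht, hm.mono (inter_subset_inter_right _ hb)⟩
    obtain ⟨p1, p2, p3⟩ := a1 _ _ m
    obtain ⟨v, n⟩ := b3 u ⟨p2, (meets_of_dist_lt p3 hm).mono (inter_subset_inter_right _ hb')⟩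
    exact ⟨v, u, m, n⟩
  · rintro v ⟨hv, hm⟩
    obtain ⟨u, n⟩ := b4 v ⟨hv, hm.mono (inter_subset_inter_right _ hb)⟩
    obtain ⟨p1, p2, p3⟩ := b1 _ _ n
    rw [dist_comm] at p3
    obtain ⟨t, m⟩ := a4 u ⟨p1, (meets_of_dist_lt p3 hm).mono (inter_subset_inter_right _ hb')⟩
    exact ⟨t, u, m, n⟩

/-- The entourages `{(T, T') | T and T' are ε-close}` for `ε > 0`. -/
def closeBasis (d : ℕ) (X : Type*) [MetricSpace X] : FilterBasis (Pattern d X × Pattern d X) where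
  sets := {U | ∃ ε : ℝ, 0 < ε ∧ U = {p | Close ε p.1 p.2}}
  nonempty := ⟨_, 1, one_pos, rfl⟩
  inter_sets := by
    rintro _ _ ⟨ε, hε, rfl⟩ ⟨δ, hδ, rfl⟩
    exact ⟨_, ⟨min ε δ, lt_min hε hδ, rfl⟩, fun p hp =>
      ⟨Close.mono (lt_min hε hδ) (min_le_left _ _) hp,
        Close.mono (lt_min hε hδ) (min_le_right _ _) hp⟩⟩

/-- The topology on patterns: a neighborhood basis of `T` is given by the sets of all patterns
`ε`-close to `T`, for `ε > 0`. -/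
instance instUniformSpace : UniformSpace (Pattern d X) :=
  UniformSpace.ofCore <| UniformSpace.Core.mkOfBasis (closeBasis d X)
    (by rintro _ ⟨ε, hε, rfl⟩ T; exact Close.refl hε T)
    (by rintro _ ⟨ε, hε, rfl⟩; exact ⟨_, ⟨ε, hε, rfl⟩, fun p hp => Close.symm hp⟩)
    (by
      rintro _ ⟨ε, hε, rfl⟩
      have hδ : 0 < min (ε / 2) ε⁻¹ := lt_min (by linarith) (inv_pos.2 hε)
      refine ⟨_, ⟨min (ε / 2) ε⁻¹, hδ, rfl⟩, ?_⟩
      rintro ⟨T, T''⟩ ⟨T', h, h'⟩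
      exact Close.trans hδ (min_le_left _ _) (min_le_right _ _) h h')

theorem uniformity_hasBasis :
    (uniformity (Pattern d X)).HasBasis (fun ε : ℝ => 0 < ε) fun ε => {p | Close ε p.1 p.2} := by
  refine ⟨fun U => ?_⟩
  have : U ∈ uniformity (Pattern d X) ↔ ∃ V ∈ closeBasis d X, V ⊆ U :=
    (closeBasis d X).mem_filter_iff
  rw [this]
  constructor
  · rintro ⟨_, ⟨ε, hε, rfl⟩, h⟩
    exact ⟨ε, hε, h⟩
  · rintro ⟨ε, hε, h⟩
    exact ⟨_, ⟨ε, hε, rfl⟩, h⟩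

theorem dist_shift (x : E d) (t u : Tile d X) : dist (t.shift x) (u.shift x) = dist t u := by
  have : dist (t.shift x).1 (u.shift x).1 = dist t.1 u.1 := by
    rw [NonemptyCompacts.dist_eq, NonemptyCompacts.dist_eq]
    simp only [Tile.shift, NonemptyCompacts.coe_map]
    exact hausdorffDist_image (Isometry.of_dist_eq fun a b => dist_sub_right a b x)
  rw [Prod.dist_eq, Prod.dist_eq, this]
  rfl

theorem shift_injective (x : E d) : Function.Injective (Tile.shift (X := X) x) := fun t u h => by
  rw [← dist_eq_zero, ← dist_shift x, h, dist_self]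

theorem continuous_shift (x : E d) : Continuous fun T : Pattern d X => T.shift x := by
  refine UniformContinuous.continuous ?_
  refine (uniformity_hasBasis.uniformContinuous_iff uniformity_hasBasis).2 fun ε hε => ?_
  have hpos : 0 < ε⁻¹ + ‖x‖ := by positivity
  have hδ : 0 < min ε (ε⁻¹ + ‖x‖)⁻¹ := lt_min hε (inv_pos.2 hpos)
  have hr : ε⁻¹ + ‖x‖ ≤ (min ε (ε⁻¹ + ‖x‖)⁻¹)⁻¹ := by
    rw [le_inv_comm₀ hpos hδ]; exact min_le_right _ _
  have key : ∀ t : Tile d X, (((t.shift x).1 : Set (E d)) ∩ ball 0 ε⁻¹).Nonempty →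
      ((t.1 : Set (E d)) ∩ ball 0 (min ε (ε⁻¹ + ‖x‖)⁻¹)⁻¹).Nonempty := by
    rintro t ⟨_, ⟨y, hy, rfl⟩, h⟩
    refine ⟨y, hy, ?_⟩
    rw [mem_ball_zero_iff] at h ⊢
    have : ‖y‖ ≤ ‖y - x‖ + ‖x‖ := by simpa using norm_add_le (y - x) x
    simp only at h
    linarith
  refine ⟨_, hδ, ?_⟩
  rintro T T' ⟨M, h1, h2, h3, h4⟩
  refine ⟨fun t u => ∃ t₀ u₀, M t₀ u₀ ∧ t₀.shift x = t ∧ u₀.shift x = u, ?_, ?_, ?_, ?_⟩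
  · rintro _ _ ⟨t, u, m, rfl, rfl⟩
    obtain ⟨a, b, c⟩ := h1 _ _ m
    exact ⟨⟨t, a, rfl⟩, ⟨u, b, rfl⟩, by rw [dist_shift]; exact c.trans_le (min_le_left _ _)⟩
  · rintro _ _ _ _ ⟨t, u, m, rfl, rfl⟩ ⟨t', u', m', rfl, rfl⟩
    rw [(shift_injective x).eq_iff, (shift_injective x).eq_iff]
    exact h2 _ _ _ _ m m'
  · rintro _ ⟨⟨t, ht, rfl⟩, hm⟩
    obtain ⟨u, m⟩ := h3 t ⟨ht, key t hm⟩
    exact ⟨_, t, u, m, rfl, rfl⟩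
  · rintro _ ⟨⟨u, hu, rfl⟩, hm⟩
    obtain ⟨t, m⟩ := h4 u ⟨hu, key u hm⟩
    exact ⟨_, t, u, m, rfl, rfl⟩

end Topology

theorem shift_shift (T : Pattern d X) (x y : E d) : (T.shift x).shift y = T.shift (x + y) := by
  ext1
  simp only [shift, image_image]
  refine image_congr fun t _ => Prod.ext (NonemptyCompacts.ext ?_) rfl
  simp only [Tile.shift, NonemptyCompacts.coe_map, image_image, sub_sub]

end Pattern

/-- A minimal aperiodic tiling space of `ℝ^d` with labels in `X`: the hull of a labeled Delone set
or of a labeled tiling, in which all orbits are dense and no element has a nonzero period. -/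
structure TilingSpace (d : ℕ) (X : Type*) [MetricSpace X] where
  carrier : Set (Pattern d X)
  is_hull : ∃ T : Pattern d X, (T.IsDelone ∨ T.IsTiling) ∧ carrier = closure T.orbit
  minimal : ∀ T ∈ carrier, carrier ⊆ closure T.orbit
  aperiodic : ∀ T ∈ carrier, ∀ x : E d, T.shift x = T → x = 0

instance {d : ℕ} {X : Type*} [MetricSpace X] : CoeSort (TilingSpace d X) (Type _) where
  coe Ω := Ω.carrier

section

variable {d : ℕ} {X X' : Type*} [MetricSpace X] [MetricSpace X']

theorem TilingSpace.shift_mem (Ω : TilingSpace d X) {T : Pattern d X} (hT : T ∈ Ω.carrier)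
    (x : E d) : T.shift x ∈ Ω.carrier := by
  obtain ⟨T₀, -, h⟩ := Ω.is_hull
  rw [h] at hT ⊢
  refine map_mem_closure (f := fun S : Pattern d X => S.shift x) (Pattern.continuous_shift x) hT ?_
  rintro _ ⟨y, rfl⟩
  exact ⟨y + x, (Pattern.shift_shift T₀ y x).symm⟩

/-- The translate `T - x` of an element of a tiling space. -/
def tmove {Ω : TilingSpace d X} (T : Ω) (x : E d) : Ω := ⟨T.1.shift x, Ω.shift_mem T.2 x⟩

/-- The translation orbit of `T` in a tiling space. -/
def orb {Ω : TilingSpace d X} (T : Ω) : Set Ω := range (tmove T)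

/-- `T` and `T'` have the same patch of radius `R` around the origin. -/
def SamePatch {Ω : TilingSpace d X} (R : ℝ) (T T' : Ω) : Prop :=
  T.1.patch 0 R = T'.1.patch 0 R

/-- The tiling space has finite local complexity. -/
def TilingSpace.FLC (Ω : TilingSpace d X) : Prop := Pattern.HasFLC Ω.carrier

/-! ### Maps between tiling spaces -/

/-- The homeomorphism `h` sends orbits to orbits. -/
def IsOrbitEquivalence {Ω : TilingSpace d X} {Ω' : TilingSpace d X'} (h : Ω ≃ₜ Ω') : Prop :=
  ∀ T, h '' orb T = orb (h T)

/-- The homeomorphism `φ` commutes with translations. -/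
def IsConjugacy {Ω : TilingSpace d X} {Ω' : TilingSpace d X'} (φ : Ω ≃ₜ Ω') : Prop :=
  ∀ T x, φ (tmove T x) = tmove (φ T) x

/-- Local maps. -/
def IsLocalMap {Ω : TilingSpace d X} {Ω' : TilingSpace d X'} (f : Ω → Ω') : Prop :=
  Continuous f ∧ ∀ r : ℝ, 0 < r → ∃ R : ℝ, 0 < R ∧
    ∀ T T' : Ω, SamePatch R T T' → SamePatch r (f T) (f T')

/-- Mutual local derivations: conjugacies that are local together with their inverse. -/
def IsMLD {Ω : TilingSpace d X} {Ω' : TilingSpace d X'} (φ : Ω ≃ₜ Ω') : Prop :=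
  IsConjugacy φ ∧ IsLocalMap φ ∧ IsLocalMap φ.symm

/-! ### Weak and strong cohomology -/

/-- The coboundary `δs (T, v) = s(T - v) - s(T)`. -/
def coboundary {Ω : TilingSpace d X} (s : Ω → E d) : Ω → E d → E d :=
  fun T v => s (tmove T v) - s T

/-- Strongly pattern-equivariant functions on `Ω`: continuous functions whose value at `T` depends
only on a patch of fixed radius of `T` around the origin. -/
def IsStronglyPE {Ω : TilingSpace d X} (s : Ω → E d) : Prop :=
  Continuous s ∧ ∃ R : ℝ, 0 < R ∧ ∀ T T' : Ω, SamePatch R T T' → s T = s T'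

theorem SamePatch.mono {Ω : TilingSpace d X} {R R' : ℝ} (h : R ≤ R') {T T' : Ω}
    (H : SamePatch R' T T') : SamePatch R T T' := by
  have key : ∀ S : Pattern d X, S.patch 0 R = (S.patch 0 R').patch 0 R := fun S => by
    ext t
    exact ⟨fun ht => ⟨⟨ht.1, ht.2.mono (inter_subset_inter_right _ (ball_subset_ball h))⟩, ht.2⟩,
      fun ht => ⟨ht.1.1, ht.2⟩⟩
  unfold SamePatch at *
  rw [key, H, ← key]

theorem IsStronglyPE.add {Ω : TilingSpace d X} {s t : Ω → E d} (hs : IsStronglyPE s)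
    (ht : IsStronglyPE t) : IsStronglyPE (s + t) := by
  obtain ⟨cs, R, hR, h⟩ := hs
  obtain ⟨ct, R', hR', h'⟩ := ht
  refine ⟨cs.add ct, max R R', lt_max_of_lt_left hR, fun T T' H => ?_⟩
  simp only [Pi.add_apply, h T T' (H.mono (le_max_left _ _)), h' T T' (H.mono (le_max_right _ _))]

theorem IsStronglyPE.zero {Ω : TilingSpace d X} : IsStronglyPE (0 : Ω → E d) :=
  ⟨continuous_const, 1, one_pos, fun _ _ _ => rfl⟩

theorem IsStronglyPE.smul {Ω : TilingSpace d X} (c : ℝ) {s : Ω → E d} (hs : IsStronglyPE s) :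
    IsStronglyPE (c • s) := by
  obtain ⟨cs, R, hR, h⟩ := hs
  exact ⟨cs.const_smul c, R, hR, fun T T' H => by simp only [Pi.smul_apply, h T T' H]⟩

/-- Weak dynamical 1-cocycles: continuous maps `α : Ω × ℝ^d → ℝ^d` with
`α(T, v) + α(T - v, w) = α(T, v + w)`. -/
def weakCocycles (Ω : TilingSpace d X) : Submodule ℝ (Ω → E d → E d) where
  carrier := {α | Continuous (fun p : Ω × E d => α p.1 p.2) ∧
    ∀ T v w, α T v + α (tmove T v) w = α T (v + w)}
  add_mem' := fun {α β} hα hβ => ⟨hα.1.add hβ.1, fun T v w => by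
    simp only [Pi.add_apply, ← hα.2, ← hβ.2]; abel⟩
  zero_mem' := ⟨continuous_const, fun T v w => by simp⟩
  smul_mem' := fun c α hα => ⟨hα.1.const_smul c, fun T v w => by
    simp only [Pi.smul_apply, ← hα.2, smul_add]⟩

/-- Weak 1-coboundaries: coboundaries of continuous functions. -/
def weakCoboundaries (Ω : TilingSpace d X) : Submodule ℝ (Ω → E d → E d) where
  carrier := {α | ∃ s : Ω → E d, Continuous s ∧ α = coboundary s}
  add_mem' := by
    rintro _ _ ⟨s, hs, rfl⟩ ⟨t, ht, rfl⟩
    exact ⟨s + t, hs.add ht, by funext T v; simp only [coboundary, Pi.add_apply]; abel⟩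
  zero_mem' := ⟨0, continuous_const, by funext T v; simp [coboundary]⟩
  smul_mem' := by
    rintro c _ ⟨s, hs, rfl⟩
    exact ⟨c • s, hs.const_smul c, by funext T v; simp [coboundary, smul_sub]⟩

/-- Strong dynamical 1-cocycles: those for which every `T ↦ α(T, v)` is strongly
pattern-equivariant. -/
def strongCocycles (Ω : TilingSpace d X) : Submodule ℝ (Ω → E d → E d) where
  carrier := {α | α ∈ weakCocycles Ω ∧ ∀ v, IsStronglyPE fun T => α T v}
  add_mem' := fun hα hβ => ⟨add_mem hα.1 hβ.1, fun v => (hα.2 v).add (hβ.2 v)⟩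
  zero_mem' := ⟨zero_mem _, fun _ => IsStronglyPE.zero⟩
  smul_mem' := fun c _ hα => ⟨Submodule.smul_mem _ c hα.1, fun v => (hα.2 v).smul c⟩

/-- Strong 1-coboundaries: coboundaries of strongly pattern-equivariant functions. -/
def strongCoboundaries (Ω : TilingSpace d X) : Submodule ℝ (Ω → E d → E d) where
  carrier := {α | ∃ s : Ω → E d, IsStronglyPE s ∧ α = coboundary s}
  add_mem' := by
    rintro _ _ ⟨s, hs, rfl⟩ ⟨t, ht, rfl⟩
    exact ⟨s + t, hs.add ht, by funext T v; simp only [coboundary, Pi.add_apply]; abel⟩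
  zero_mem' := ⟨0, IsStronglyPE.zero, by funext T v; simp [coboundary]⟩
  smul_mem' := by
    rintro c _ ⟨s, hs, rfl⟩
    exact ⟨c • s, hs.smul c, by funext T v; simp [coboundary, smul_sub]⟩

/-- The weak cohomology group `H^1_w(Ω; ℝ^d)`. -/
abbrev WeakH1 (Ω : TilingSpace d X) : Type _ :=
  weakCocycles Ω ⧸ (weakCoboundaries Ω).submoduleOf (weakCocycles Ω)

/-- The strong cohomology group `H^1_s(Ω; ℝ^d)`. -/
abbrev StrongH1 (Ω : TilingSpace d X) : Type _ :=
  strongCocycles Ω ⧸ (strongCoboundaries Ω).submoduleOf (strongCocycles Ω)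

/-! ### The classes of an orbit equivalence -/

/-- `α` is the cocycle `(T, v) ↦ f_T(v)` of the map `f`: `f(T - v) = f(T) - α(T, v)`. By
aperiodicity `f` has at most one such `α`. -/
def IsCocycleOf {Ω : TilingSpace d X} {Ω' : TilingSpace d X'} (f : Ω → Ω')
    (α : Ω → E d → E d) : Prop :=
  ∀ T v, f (tmove T v) = tmove (f T) (α T v)

open Classical in
/-- The weak class `[h] ∈ H^1_w(Ω; ℝ^d)`: the class of the cocycle of `h`. For an orbit equivalence
this cocycle exists, is unique and is continuous (the value `0` is only for other maps). -/
def weakClass {Ω : TilingSpace d X} {Ω' : TilingSpace d X'} (h : Ω → Ω') : WeakH1 Ω :=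
  if H : ∃ α : weakCocycles Ω, IsCocycleOf h α then Submodule.Quotient.mk H.choose else 0

/-- `α` is a strong cocycle of a perturbation of `h`: there is a continuous `s : Ω → ℝ^d` such that
`h_s : T ↦ h(T) - s(T)` is a local map (equivalently, maps transversals into transversals) and `α`
is the cocycle of `h_s`. -/
def IsStrongRepresentative {Ω : TilingSpace d X} {Ω' : TilingSpace d X'} (h : Ω → Ω')
    (α : strongCocycles Ω) : Prop :=
  ∃ s : Ω → E d, Continuous s ∧ IsLocalMap (fun T => tmove (h T) (s T)) ∧
    IsCocycleOf (fun T => tmove (h T) (s T)) α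

open Classical in
/-- The strong class `[h] ∈ H^1_s(Ω; ℝ^d)` of a homeomorphism `h` of FLC tiling spaces: the class of
the cocycle of a perturbation `h_s` of `h` that is a local map. For FLC spaces such a perturbation
exists and the class does not depend on it (the value `0` is only for other maps or spaces). -/
def strongClass {Ω : TilingSpace d X} {Ω' : TilingSpace d X'} (h : Ω → Ω') : StrongH1 Ω :=
  if H : ∃ α : strongCocycles Ω, IsStrongRepresentative h α
  then Submodule.Quotient.mk H.choose else 0

end

end TilingClassification

end

noncomputable section

namespace TilingClassification

/-! ### Translations of tiles and patterns -/

namespace Tile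

variable {d : ℕ} {X : Type*}

/-! Suppose the cocycles satisfy `α₁ = α₂ + δσ`. Then `f(T) = h₂(T) - σ(T)` has the same cocycle as
`h₁`, so `φ = f ∘ h₁⁻¹` commutes with translations. The map `f` is injective because `f(T) = f(T')`
puts `T` and `T' = T - v` on one orbit with `α₁(T, v) = 0`, whence `h₁(T') = h₁(T)`. It is onto
because its closed image contains a full orbit, which is dense. Compactness makes it a
homeomorphism, and `s` is obtained by transporting `σ` through the cocycle of `h₂⁻¹`
(`exists_conjugacy_of_cohomologous`).

This requires that tiling spaces be compact Hausdorff with a continuous action, which follows from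
uniform separation and bounded diameter of the tiles, and that cocycles be continuous. For the
latter, aperiodicity and compactness forbid close returns under displacements of norm in `[a, b]`,
`a > 0`. A Baire category argument then gives continuity along each orbit
(`continuous_of_continuous_tmove`), and the intermediate value theorem and compactness give joint
continuity.

In the FLC case, close patterns agree on a large ball after a small translation. Averaging local
displacements with pattern-equivariant weights perturbs an orbit equivalence into a local map
(`exists_local_perturbation`, `IsOrbitEquivalence.exists_isStrongRepresentative`). When the strong
classes agree, `φ` carries a local perturbation of `h₁` to one of `h₂`; rigidity of patches under
small translations then makes `φ` and its inverse local (`isLocalMap_of_intertwines`). -/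

theorem mem_shift {x y : E d} {t : Tile d X} : y ∈ (Tile.shift x t).1 ↔ y + x ∈ t.1 := by
  rw [← SetLike.mem_coe, Tile.shift, NonemptyCompacts.coe_map]
  constructor
  · rintro ⟨z, hz, rfl⟩
    simpa using hz
  · intro h
    exact ⟨y + x, h, by simp⟩

theorem shift_add (x y : E d) (t : Tile d X) :
    Tile.shift y (Tile.shift x t) = Tile.shift (x + y) t := by
  refine Prod.ext (NonemptyCompacts.ext (Set.ext fun z => ?_)) rfl
  simp only [SetLike.mem_coe, mem_shift]
  rw [add_assoc, add_comm y x]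

theorem shift_zero (t : Tile d X) : Tile.shift 0 t = t := by
  refine Prod.ext (NonemptyCompacts.ext (Set.ext fun z => ?_)) rfl
  simp only [SetLike.mem_coe, mem_shift, add_zero]

theorem meets_shift {x c : E d} {R : ℝ} {t : Tile d X} :
    (((Tile.shift x t).1 : Set (E d)) ∩ ball c R).Nonempty ↔
      ((t.1 : Set (E d)) ∩ ball (c + x) R).Nonempty := by
  constructor
  · rintro ⟨y, hy, hr⟩
    exact ⟨y + x, mem_shift.1 hy, by simpa [mem_ball, dist_eq_norm] using hr⟩
  · rintro ⟨y, hy, hr⟩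
    refine ⟨y - x, mem_shift.2 (by simpa using hy), ?_⟩
    rw [mem_ball, dist_eq_norm] at hr ⊢
    rwa [sub_sub, add_comm x c]

theorem exists_dist_lt {t u : Tile d X} {δ : ℝ} (h : dist t.1 u.1 < δ) {y : E d} (hy : y ∈ t.1) :
    ∃ z ∈ u.1, dist y z < δ := by
  rw [NonemptyCompacts.dist_eq] at h
  exact exists_dist_lt_of_hausdorffDist_lt hy h
    (hausdorffEDist_ne_top_of_nonempty_of_bounded t.1.nonempty u.1.nonempty
      t.1.isCompact.isBounded u.1.isCompact.isBounded)

/-- A nonzero period `x` would put all points `y + n • x` in a bounded tile. -/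
theorem shift_eq_self {x : E d} {t : Tile d X} (h : Tile.shift x t = t) : x = 0 := by
  by_contra hx
  have hx' : 0 < ‖x‖ := norm_pos_iff.2 hx
  obtain ⟨y, hy⟩ := t.1.nonempty
  have hn : ∀ n : ℕ, y + (n : ℝ) • x ∈ t.1 := by
    intro n
    induction n with
    | zero => simpa using hy
    | succ n ih =>
      rw [← h] at ih
      have := mem_shift.1 ih
      convert this using 1
      push_cast
      rw [add_smul, one_smul]; abel
  obtain ⟨C, hC⟩ := t.1.isCompact.isBounded.exists_norm_le
  obtain ⟨n, hn'⟩ := exists_nat_gt ((C + ‖y‖) / ‖x‖)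
  rw [div_lt_iff₀ hx'] at hn'
  have h1 := hC _ (hn n)
  have h2 : ‖(n : ℝ) • x‖ ≤ ‖y + (n : ℝ) • x‖ + ‖y‖ := by
    simpa using norm_sub_le (y + (n : ℝ) • x) y
  rw [norm_smul, Real.norm_natCast] at h2
  linarith

variable [MetricSpace X]

theorem dist_fst_le (t u : Tile d X) : dist t.1 u.1 ≤ dist t u := le_max_left _ _

theorem dist_shift_shift_le (x y : E d) (t : Tile d X) :
    dist (Tile.shift x t) (Tile.shift y t) ≤ ‖x - y‖ := by
  have : dist (Tile.shift x t).1 (Tile.shift y t).1 ≤ ‖x - y‖ := by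
    rw [NonemptyCompacts.dist_eq]
    refine hausdorffDist_le_of_mem_dist (norm_nonneg _) ?_ ?_
    · intro z hz
      refine ⟨z + x - y, mem_shift.2 (by simpa using mem_shift.1 hz), ?_⟩
      rw [dist_eq_norm, ← norm_neg]; apply le_of_eq; congr 1; abel
    · intro z hz
      refine ⟨z + y - x, mem_shift.2 (by simpa using mem_shift.1 hz), ?_⟩
      rw [dist_eq_norm]; apply le_of_eq; congr 1; abel
  rw [Prod.dist_eq]
  exact max_le this (by simp [Tile.shift])

theorem dist_shift_self_le (x : E d) (t : Tile d X) : dist (Tile.shift x t) t ≤ ‖x‖ := by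
  simpa [shift_zero] using dist_shift_shift_le x 0 t

theorem isCompact_subset_closedBall [CompactSpace X] (R : ℝ) :
    IsCompact {t : Tile d X | (t.1 : Set (E d)) ⊆ closedBall 0 R} := by
  have := (NonemptyCompacts.isCompact_subsets_of_isCompact
    (isCompact_closedBall (0 : E d) R)).prod (isCompact_univ (X := X))
  convert this using 1
  ext t
  simp

end Tile

namespace Pattern

variable {d : ℕ} {X : Type*}

theorem mem_shift {T : Pattern d X} {x : E d} {t : Tile d X} :
    t ∈ (T.shift x).tiles ↔ Tile.shift (-x) t ∈ T.tiles := by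
  constructor
  · rintro ⟨u, hu, rfl⟩
    rwa [Tile.shift_add, add_neg_cancel, Tile.shift_zero]
  · intro h
    exact ⟨_, h, by rw [Tile.shift_add, neg_add_cancel, Tile.shift_zero]⟩

theorem shift_mem_shift {T : Pattern d X} {x : E d} {t : Tile d X} :
    Tile.shift x t ∈ (T.shift x).tiles ↔ t ∈ T.tiles := by
  rw [mem_shift, Tile.shift_add, add_neg_cancel, Tile.shift_zero]

theorem shift_zero (T : Pattern d X) : T.shift 0 = T := by
  ext t
  rw [mem_shift, neg_zero, Tile.shift_zero]

theorem patch_shift (T : Pattern d X) (x c : E d) (R : ℝ) :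
    (T.shift x).patch c R = (T.patch (c + x) R).shift x := by
  ext t
  obtain ⟨u, rfl⟩ : ∃ u, Tile.shift x u = t :=
    ⟨Tile.shift (-x) t, by rw [Tile.shift_add, neg_add_cancel, Tile.shift_zero]⟩
  rw [shift_mem_shift]
  simp only [patch, mem_ofPred_eq, Tile.meets_shift, shift_mem_shift]

/-! ### Patterns of uniformly separated tiles -/

/-- Distinct tiles have shapes at Hausdorff distance at least `r`, and tiles have diameter at most
`D`. -/
structure IsRegular (r D : ℝ) (T : Pattern d X) : Prop where
  separated : ∀ t ∈ T.tiles, ∀ u ∈ T.tiles, t ≠ u → r ≤ dist t.1 u.1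
  bounded : ∀ t ∈ T.tiles, ∀ x ∈ t.1, ∀ y ∈ t.1, dist x y ≤ D

theorem IsRegular.shift {r D : ℝ} {T : Pattern d X} (hT : T.IsRegular r D) (x : E d) :
    (T.shift x).IsRegular r D := by
  constructor
  · rintro _ ⟨t, ht, rfl⟩ _ ⟨u, hu, rfl⟩ hne
    have : dist (Tile.shift x t).1 (Tile.shift x u).1 = dist t.1 u.1 := by
      have := dist_shift (X := Unit) x (t.1, ()) (u.1, ())
      rwa [Prod.dist_eq, Prod.dist_eq, dist_self, max_eq_left dist_nonneg,
        max_eq_left dist_nonneg] at this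
    rw [this]
    exact hT.separated t ht u hu fun h => hne (h ▸ rfl)
  · rintro _ ⟨t, ht, rfl⟩ y hy z hz
    simpa using hT.bounded t ht _ (Tile.mem_shift.1 hy) _ (Tile.mem_shift.1 hz)

theorem IsRegular.patch_subset {r D : ℝ} {T : Pattern d X} (hT : T.IsRegular r D) (R : ℝ) :
    (T.patch 0 R).tiles ⊆ {t : Tile d X | (t.1 : Set (E d)) ⊆ closedBall 0 (R + D)} := by
  rintro t ⟨ht, y, hy, hyR⟩ z hz
  rw [mem_ball] at hyR
  rw [mem_closedBall]
  linarith [dist_triangle z y 0, hT.bounded t ht z hz y hy]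

/-! ### Limits and compactness of regular patterns -/

variable [MetricSpace X]

theorem mem_closure_iff_close {S : Set (Pattern d X)} {T : Pattern d X} :
    T ∈ closure S ↔ ∀ ε > 0, ∃ T' ∈ S, Close ε T T' := by
  rw [mem_closure_iff_nhds_basis (nhds_basis_uniformity' uniformity_hasBasis)]
  rfl

theorem close_shift_shift {ε : ℝ} {x y : E d} (h : ‖x - y‖ < ε) (T : Pattern d X) :
    Close ε (T.shift x) (T.shift y) := by
  refine ⟨fun t u => ∃ t₀ ∈ T.tiles, Tile.shift x t₀ = t ∧ Tile.shift y t₀ = u, ?_, ?_, ?_, ?_⟩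
  · rintro _ _ ⟨t, ht, rfl, rfl⟩
    exact ⟨⟨t, ht, rfl⟩, ⟨t, ht, rfl⟩, (Tile.dist_shift_shift_le x y t).trans_lt h⟩
  · rintro _ _ _ _ ⟨t, ht, rfl, rfl⟩ ⟨t', ht', rfl, rfl⟩
    rw [(shift_injective x).eq_iff, (shift_injective y).eq_iff]
  · rintro _ ⟨⟨t, ht, rfl⟩, -⟩
    exact ⟨_, t, ht, rfl, rfl⟩
  · rintro _ ⟨⟨t, ht, rfl⟩, -⟩
    exact ⟨_, t, ht, rfl, rfl⟩

theorem continuous_shift_uncurry : Continuous fun p : Pattern d X × E d => p.1.shift p.2 := by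
  rw [continuous_iff_continuousAt]
  rintro ⟨T, x⟩
  rw [ContinuousAt, Uniform.tendsto_nhds_right, tendsto_def]
  intro U hU
  obtain ⟨V, hV, hVU⟩ := comp_mem_uniformity_sets hU
  obtain ⟨ε, hε, hεV⟩ := uniformity_hasBasis.mem_iff.1 hV
  have h1 : ∀ᶠ p : Pattern d X × E d in 𝓝 (T, x), (T.shift x, p.1.shift x) ∈ V :=
    (Uniform.tendsto_nhds_right.1 ((continuous_shift x).tendsto T) |>.comp
      (continuous_fst.tendsto (T, x))) hV
  have h2 : ∀ᶠ p : Pattern d X × E d in 𝓝 (T, x), ‖x - p.2‖ < ε := by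
    have : Tendsto (fun p : Pattern d X × E d => ‖x - p.2‖) (𝓝 (T, x)) (𝓝 ‖x - x‖) :=
      (Continuous.tendsto (by fun_prop) _)
    rw [sub_self, norm_zero] at this
    exact this.eventually (gt_mem_nhds hε)
  filter_upwards [h1, h2] with p hp1 hp2
  exact hVU ⟨_, hp1, hεV (close_shift_shift hp2 p.1)⟩

theorem IsRegular.eq_of_dist_lt {r D : ℝ} {T : Pattern d X} (hT : T.IsRegular r D) {t u : Tile d X}
    (ht : t ∈ T.tiles) (hu : u ∈ T.tiles) (h : dist t u < r) : t = u := by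
  by_contra hne
  linarith [hT.separated t ht u hu hne, Tile.dist_fst_le t u]

/-- Every given tile takes part in the correspondence of sufficiently close patterns. -/
theorem eventually_exists_dist_lt {T : Pattern d X} {t : Tile d X} (ht : t ∈ T.tiles) :
    ∃ ε₀ > 0, ∀ ε > 0, ε ≤ ε₀ → ∀ T', Close ε T T' → ∃ u ∈ T'.tiles, dist t u < ε := by
  obtain ⟨y, hy⟩ := t.1.nonempty
  have h0 : 0 < ‖y‖ + 1 := by positivity
  refine ⟨(‖y‖ + 1)⁻¹, by positivity, fun ε hε hle T' ⟨M, h1, h2, h3, h4⟩ => ?_⟩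
  have : ‖y‖ + 1 ≤ ε⁻¹ := by rwa [le_inv_comm₀ h0 hε]
  obtain ⟨u, m⟩ := h3 t ⟨ht, y, hy, by rw [mem_ball_zero_iff]; linarith⟩
  exact ⟨u, (h1 _ _ m).2⟩

theorem isClosed_setOf_isRegular (r D : ℝ) : IsClosed {T : Pattern d X | T.IsRegular r D} := by
  refine isClosed_of_closure_subset fun T hT => ?_
  rw [mem_closure_iff_close] at hT
  constructor
  · intro t ht u hu hne
    obtain ⟨a, ha, Ha⟩ := eventually_exists_dist_lt ht
    obtain ⟨b, hb, Hb⟩ := eventually_exists_dist_lt hu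
    refine le_of_forall_pos_le_add fun ε hε => ?_
    have hpos : 0 < dist t u / 2 := half_pos (dist_pos.2 hne)
    -- The bound by `dist t u / 2` keeps the approximating tiles distinct, so that their separation
    -- applies.
    obtain ⟨δ, hδ, hδ'⟩ : ∃ δ > 0, δ ≤ a ∧ δ ≤ b ∧ δ ≤ ε / 2 ∧ δ ≤ dist t u / 2 :=
      ⟨min (min a b) (min (ε / 2) (dist t u / 2)), by positivity, by simp⟩
    obtain ⟨T', hT', hc⟩ := hT δ hδ
    obtain ⟨t', ht', h1⟩ := Ha δ hδ hδ'.1 T' hc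
    obtain ⟨u', hu', h2⟩ := Hb δ hδ hδ'.2.1 T' hc
    have hne' : t' ≠ u' := by
      rintro rfl
      linarith [dist_triangle_right t u t', hδ'.2.2.2]
    have h3 := hT'.separated t' ht' u' hu' hne'
    have h4 := Tile.dist_fst_le t t'
    have h5 := Tile.dist_fst_le u u'
    have h6 := dist_triangle4_right t'.1 u'.1 t.1 u.1
    rw [dist_comm t'.1 t.1, dist_comm u'.1 u.1] at h6
    linarith [hδ'.2.2.1]
  · intro t ht x hx y hy
    obtain ⟨a, ha, Ha⟩ := eventually_exists_dist_lt ht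
    refine le_of_forall_pos_le_add fun ε hε => ?_
    obtain ⟨δ, hδ, hδ'⟩ : ∃ δ > 0, δ ≤ a ∧ δ ≤ ε / 2 := ⟨min a (ε / 2), by positivity, by simp⟩
    obtain ⟨T', hT', hc⟩ := hT δ hδ
    obtain ⟨t', ht', h1⟩ := Ha δ hδ hδ'.1 T' hc
    have h1' := (Tile.dist_fst_le t t').trans_lt h1
    obtain ⟨x', hx', h2⟩ := Tile.exists_dist_lt h1' hx
    obtain ⟨y', hy', h3⟩ := Tile.exists_dist_lt h1' hy
    have h4 := hT'.bounded t' ht' x' hx' y' hy'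
    have h5 := dist_triangle4_right x y x' y'
    linarith

/-- By separation, all tiles of `T'` within `r / 2` of a given tile of `T` coincide, so this single
tile is at distance zero from it. -/
theorem IsRegular.eq_of_forall_close {r D : ℝ} (hr : 0 < r) {T T' : Pattern d X}
    (hT : T.IsRegular r D) (hT' : T'.IsRegular r D) (h : ∀ ε > 0, Close ε T T') : T = T' := by
  have key : ∀ {T T' : Pattern d X}, T'.IsRegular r D → (∀ ε > 0, Close ε T T') →
      ∀ t ∈ T.tiles, t ∈ T'.tiles := by
    intro T T' hT' h t ht
    obtain ⟨a, ha, Ha⟩ := eventually_exists_dist_lt ht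
    obtain ⟨δ, hδ, hδ'⟩ : ∃ δ > 0, δ ≤ a ∧ δ ≤ r / 2 := ⟨min a (r / 2), by positivity, by simp⟩
    obtain ⟨u, hu, hd⟩ := Ha δ hδ hδ'.1 T' (h δ hδ)
    have : dist t u ≤ 0 := by
      refine le_of_forall_pos_lt_add fun ε hε => ?_
      obtain ⟨δ', hδ1, hδ2⟩ : ∃ δ' > 0, δ' ≤ δ ∧ δ' ≤ ε := ⟨min δ ε, by positivity, by simp⟩
      obtain ⟨u', hu', hd'⟩ := Ha δ' hδ1 (hδ2.1.trans hδ'.1) T' (h δ' hδ1)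
      have : u' = u := hT'.eq_of_dist_lt hu' hu
        (by linarith [dist_triangle_left u' u t, hδ'.2, hδ2.1])
      subst this
      linarith
    rwa [dist_le_zero.1 this]
  ext t
  exact ⟨key hT' h t, key hT (fun ε hε => (h ε hε).symm) t⟩

/-- The patch lies in a compact set of tiles, and a set of radius `r / 2` around one centre contains
at most one tile of the patch. -/
theorem IsRegular.finite_patch [CompactSpace X] {r D : ℝ} (hr : 0 < r) {T : Pattern d X}
    (hT : T.IsRegular r D) (R : ℝ) : (T.patch 0 R).tiles.Finite := by
  obtain ⟨F, -, hF, hcov⟩ := ((Tile.isCompact_subset_closedBall (d := d) (X := X)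
    (R + D)).totallyBounded.subset (hT.patch_subset R)).exists_subset
      (dist_mem_uniformity (half_pos hr))
  choose! c hc using fun t (ht : t ∈ (T.patch 0 R).tiles) => mem_iUnion₂.1 (hcov ht)
  refine Finite.of_finite_image (hF.subset (image_subset_iff.2 fun t ht => (hc t ht).1)) ?_
  intro t ht u hu hEq
  refine hT.eq_of_dist_lt ht.1 hu.1 ?_
  have h1 : dist t (c t) < r / 2 := (hc t ht).2
  have h2 : dist u (c u) < r / 2 := (hc u hu).2
  rw [← hEq] at h2
  linarith [dist_triangle_right t u (c t)]

theorem isCompact_setOf_isRegular [CompactSpace X] {r : ℝ} (hr : 0 < r) (D : ℝ) :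
    IsCompact {T : Pattern d X | T.IsRegular r D} := by
  rw [isCompact_iff_ultrafilter_le_nhds']
  intro 𝓕 hF
  -- The candidate limit consists of the tiles approximated by tiles of `𝓕`-almost every pattern.
  let L : Pattern d X := ⟨{t | ∀ ε > 0, {T : Pattern d X | ∃ u ∈ T.tiles, dist t u < ε} ∈ 𝓕}⟩
  have hL : L.IsRegular r D := by
    constructor
    · intro t ht u hu hne
      refine le_of_forall_pos_le_add fun ε hε => ?_
      have hpos : 0 < dist t u / 2 := half_pos (dist_pos.2 hne)
      obtain ⟨δ, hδ, hδ'⟩ : ∃ δ > 0, δ ≤ ε / 2 ∧ δ ≤ dist t u / 2 :=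
        ⟨min (ε / 2) (dist t u / 2), by positivity, by simp⟩
      obtain ⟨T, ⟨hT, t', ht', h1⟩, u', hu', h2⟩ :=
        𝓕.nonempty_of_mem (inter_mem (inter_mem hF (ht δ hδ)) (hu δ hδ))
      have hne' : t' ≠ u' := by
        rintro rfl
        linarith [dist_triangle_right t u t', hδ'.2]
      have h3 := hT.separated t' ht' u' hu' hne'
      have h4 := Tile.dist_fst_le t t'
      have h5 := Tile.dist_fst_le u u'
      have h6 := dist_triangle4_right t'.1 u'.1 t.1 u.1
      rw [dist_comm t'.1 t.1, dist_comm u'.1 u.1] at h6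
      linarith [hδ'.1]
    · intro t ht x hx y hy
      refine le_of_forall_pos_le_add fun ε hε => ?_
      obtain ⟨T, hT, t', ht', h1⟩ := 𝓕.nonempty_of_mem (inter_mem hF (ht (ε / 2) (half_pos hε)))
      have h1' := (Tile.dist_fst_le t t').trans_lt h1
      obtain ⟨x', hx', h2⟩ := Tile.exists_dist_lt h1' hx
      obtain ⟨y', hy', h3⟩ := Tile.exists_dist_lt h1' hy
      have h4 := hT.bounded t' ht' x' hx' y' hy'
      have h5 := dist_triangle4_right x y x' y'
      linarith
  refine ⟨L, hL, ?_⟩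
  have main : ∀ ε > 0, ε ≤ r / 2 → {T | Close ε L T} ∈ 𝓕 := by
    intro ε hε hεr
    have A : {T : Pattern d X | ∀ t ∈ (L.patch 0 ε⁻¹).tiles, ∃ u ∈ T.tiles, dist t u < ε} ∈ 𝓕 := by
      have := (biInter_mem (hL.finite_patch hr ε⁻¹)).2 fun t ht => ht.1 ε hε
      filter_upwards [this] with T hT
      simpa using hT
    -- Otherwise `𝓕`-almost every pattern has a tile near the origin that is `ε`-far from `L`. By
    -- compactness these tiles converge along `𝓕`, and their limit belongs to `L` by definition.
    have B : {T : Pattern d X | ∀ u ∈ (T.patch 0 ε⁻¹).tiles, ∃ t ∈ L.tiles, dist t u < ε} ∈ 𝓕 := by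
      by_contra hB
      rw [← Ultrafilter.compl_mem_iff_notMem] at hB
      have hex : ∀ T : Pattern d X, ∃ u : Tile d X, T.IsRegular r D →
          T ∈ {T : Pattern d X | ∀ u ∈ (T.patch 0 ε⁻¹).tiles, ∃ t ∈ L.tiles, dist t u < ε}ᶜ →
          u ∈ (T.patch 0 ε⁻¹).tiles ∧ ∀ t ∈ L.tiles, ε ≤ dist t u := by
        intro T
        by_cases h : T ∈ {T : Pattern d X |
            ∀ u ∈ (T.patch 0 ε⁻¹).tiles, ∃ t ∈ L.tiles, dist t u < ε}ᶜ
        · have h' := h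
          simp only [mem_compl_iff, mem_ofPred_eq, not_forall, not_exists, not_and, not_lt] at h'
          obtain ⟨u, hu, h2⟩ := h'
          exact ⟨u, fun _ _ => ⟨hu, h2⟩⟩
        -- Elsewhere any tile will do; one is borrowed from a pattern where `B` fails.
        · obtain ⟨T₁, hT₁⟩ := 𝓕.nonempty_of_mem hB
          simp only [mem_compl_iff, mem_ofPred_eq, not_forall] at hT₁
          exact ⟨hT₁.choose, fun _ h' => absurd h' h⟩
      choose c hc using hex
      have hmem : {t : Tile d X | (t.1 : Set (E d)) ⊆ closedBall 0 (ε⁻¹ + D)} ∈ 𝓕.map c := by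
        rw [Ultrafilter.mem_map]
        filter_upwards [hF, hB] with T hT hT2
        exact hT.patch_subset _ (hc T hT hT2).1
      obtain ⟨u, -, hu⟩ := isCompact_iff_ultrafilter_le_nhds'.1
        (Tile.isCompact_subset_closedBall (d := d) (X := X) (ε⁻¹ + D)) (𝓕.map c) hmem
      have hball : ∀ δ > 0, {T | dist u (c T) < δ} ∈ 𝓕 := fun δ hδ => by
        have := hu (ball_mem_nhds u hδ)
        filter_upwards [this] with T hT
        rw [dist_comm]
        exact hT
      have huL : u ∈ L.tiles := by
        intro δ hδ
        filter_upwards [hF, hB, hball δ hδ] with T hT hT2 hT3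
        exact ⟨c T, (hc T hT hT2).1.1, hT3⟩
      obtain ⟨T, ⟨hT, hT2⟩, hT3⟩ := 𝓕.nonempty_of_mem (inter_mem (inter_mem hF hB) (hball ε hε))
      have := (hc T hT hT2).2 u huL
      simp only [mem_ofPred_eq] at hT3
      linarith
    filter_upwards [hF, A, B] with T hT hA hB
    -- Since `ε ≤ r / 2`, separation on both sides makes this relation one-to-one.
    refine ⟨fun t u => t ∈ L.tiles ∧ u ∈ T.tiles ∧ dist t u < ε, fun _ _ h => h, ?_, ?_, ?_⟩
    · rintro t u t' u' ⟨h1, h2, h3⟩ ⟨h1', h2', h3'⟩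
      constructor
      · rintro rfl
        exact hT.eq_of_dist_lt h2 h2' (by linarith [dist_triangle_left u u' t])
      · rintro rfl
        exact hL.eq_of_dist_lt h1 h1' (by linarith [dist_triangle_right t t' u])
    · intro t ht
      obtain ⟨u, hu, h⟩ := hA t ht
      exact ⟨u, ht.1, hu, h⟩
    · intro u hu
      obtain ⟨t, ht, h⟩ := hB u hu
      exact ⟨t, ht, hu.1, h⟩
  rw [(nhds_basis_uniformity' uniformity_hasBasis).ge_iff]
  intro ε hε
  have h1 : 0 < min ε (r / 2) := by positivity
  filter_upwards [main _ h1 (min_le_right _ _)] with T hT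
  exact Close.mono h1 (min_le_left _ _) hT

end Pattern

end TilingClassification

namespace TilingClassification

/-! ### Regularity of Delone sets and tilings -/

namespace Pattern

variable {d : ℕ} {X : Type*}

theorem IsPolytope.convex {a : NonemptyCompacts (E d)} (ha : IsPolytope a) :
    Convex ℝ (a : Set (E d)) := by
  obtain ⟨⟨F, hF⟩, -⟩ := ha
  rw [hF]
  exact convex_convexHull ℝ _

/-- A convex body close to one that contains a ball contains a smaller ball. -/
theorem ball_subset_of_dist_lt {a b : NonemptyCompacts (E d)} {c : E d} {ρ : ℝ}
    (ha : ball c (2 * ρ) ⊆ (a : Set (E d))) (hb : Convex ℝ (b : Set (E d))) (hab : dist a b < ρ) :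
    ball c ρ ⊆ (b : Set (E d)) := by
  intro x hx
  by_contra hxb
  have hρ : 0 < ρ := dist_nonneg.trans_lt hab
  -- If `p` is the projection of `x` to `b`, then `b` lies in the half-space `⟪n, w - p⟫ ≤ 0`. The
  -- point `x + ρ • n` of `a` is therefore more than `ρ` away from `b`.
  obtain ⟨p, hp, hmin⟩ :=
    exists_norm_eq_iInf_of_complete_convex b.nonempty b.isCompact.isComplete hb x
  rw [norm_eq_iInf_iff_real_inner_le_zero hb hp] at hmin
  have hxp : 0 < ‖x - p‖ := by
    rw [norm_pos_iff, sub_ne_zero]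
    rintro rfl
    exact hxb hp
  set n : E d := ‖x - p‖⁻¹ • (x - p) with hn
  have hn1 : ‖n‖ = 1 := by
    rw [hn, norm_smul, norm_inv, norm_norm, inv_mul_cancel₀ hxp.ne']
  have hy : x + ρ • n ∈ (a : Set (E d)) := by
    apply ha
    rw [mem_ball, dist_eq_norm] at hx ⊢
    calc ‖x + ρ • n - c‖ = ‖(x - c) + ρ • n‖ := by congr 1; abel
      _ ≤ ‖x - c‖ + ‖ρ • n‖ := norm_add_le _ _
      _ < 2 * ρ := by rw [norm_smul, hn1, Real.norm_of_nonneg hρ.le]; linarith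
  obtain ⟨w, hw, hyw⟩ := Tile.exists_dist_lt (t := (a, ())) (u := (b, ())) hab hy
  have h1 : inner ℝ n (x + ρ • n - w) ≤ ‖x + ρ • n - w‖ := by
    simpa [hn1] using real_inner_le_norm n (x + ρ • n - w)
  have h2 : inner ℝ n (w - p) ≤ 0 := by
    rw [hn, real_inner_smul_left]
    exact mul_nonpos_of_nonneg_of_nonpos (by positivity) (hmin w hw)
  have h3 : inner ℝ n (x - p) = ‖x - p‖ := by
    rw [hn, real_inner_smul_left, real_inner_self_eq_norm_sq]
    field_simp
  have h4 : inner ℝ n (x + ρ • n - w) = inner ℝ n (x - p) + ρ - inner ℝ n (w - p) := by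
    have : x + ρ • n - w = (x - p) + ρ • n - (w - p) := by abel
    rw [this, inner_sub_right, inner_add_right, real_inner_smul_right, real_inner_self_eq_norm_sq,
      hn1]
    ring
  rw [dist_eq_norm] at hyw
  linarith

/-- A compact set of polytopes has a positive common inradius. -/
theorem exists_inradius {A : Set (NonemptyCompacts (E d))} (hA : IsCompact A)
    (hpoly : ∀ a ∈ A, IsPolytope a) :
    ∃ ρ > 0, ∀ a ∈ A, ∃ c, ball c ρ ⊆ (a : Set (E d)) := by
  -- The neighborhoods used in the compactness induction need not lie in `A`, so being a polytope
  -- becomes part of the induced property.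
  suffices ∃ ρ > 0, ∀ a ∈ A, IsPolytope a → ∃ c, ball c ρ ⊆ (a : Set (E d)) by
    obtain ⟨ρ, hρ, h⟩ := this
    exact ⟨ρ, hρ, fun a ha => h a ha (hpoly a ha)⟩
  refine hA.induction_on (p := fun s => ∃ ρ > 0, ∀ a ∈ s, IsPolytope a →
    ∃ c, ball c ρ ⊆ (a : Set (E d))) ⟨1, one_pos, by simp⟩ ?_ ?_ ?_
  · rintro s t hst ⟨ρ, hρ, h⟩
    exact ⟨ρ, hρ, fun a ha => h a (hst ha)⟩
  · rintro s t ⟨ρ, hρ, h⟩ ⟨ρ', hρ', h'⟩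
    refine ⟨min ρ ρ', by positivity, ?_⟩
    rintro a (ha | ha) hp
    · obtain ⟨c, hc⟩ := h a ha hp
      exact ⟨c, (ball_subset_ball (min_le_left _ _)).trans hc⟩
    · obtain ⟨c, hc⟩ := h' a ha hp
      exact ⟨c, (ball_subset_ball (min_le_right _ _)).trans hc⟩
  · intro a ha
    obtain ⟨c, hc⟩ := (hpoly a ha).2
    obtain ⟨ε, hε, hball⟩ := Metric.isOpen_iff.1 isOpen_interior c hc
    refine ⟨ball a (ε / 2), mem_nhdsWithin_of_mem_nhds (ball_mem_nhds a (half_pos hε)), ε / 2,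
      half_pos hε, fun b hb hp => ⟨c, ?_⟩⟩
    refine ball_subset_of_dist_lt (a := a) ?_ hp.convex (by rwa [dist_comm])
    rw [mul_div_cancel₀ _ two_ne_zero]
    exact hball.trans interior_subset

/-- A tile closer than the inradius `r` to `t` would meet an open ball inside `t`, hence the
interior of `t`. -/
theorem IsTiling.exists_isRegular {T : Pattern d X} (hT : T.IsTiling) :
    ∃ r > 0, ∃ D, T.IsRegular r D ∧ ∃ ρ > 0, ∀ x, (T.patch x ρ).tiles.Nonempty := by
  obtain ⟨⟨A, hA, hpoly, hTA⟩, hcov, hdisj⟩ := hT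
  obtain ⟨r, hr, hin⟩ := exists_inradius hA hpoly
  obtain ⟨D, hD⟩ := isBounded_iff.1
    (NonemptyCompacts.isCompact_biUnion_coe_of_isCompact hA).isBounded
  refine ⟨r, hr, D, ⟨?_, ?_⟩, 1, one_pos, ?_⟩
  · intro t ht u hu hne
    by_contra! hlt
    obtain ⟨a, ha, x, hx⟩ := hTA t ht
    obtain ⟨c, hc⟩ := hin a ha
    have hball : ball (c + x) r ⊆ (t.1 : Set (E d)) := by
      rw [hx]
      intro y hy
      refine ⟨y - x, hc ?_, by simp⟩
      rw [mem_ball, dist_eq_norm] at hy ⊢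
      rwa [sub_sub, add_comm x c]
    obtain ⟨z, hz, hcz⟩ := Tile.exists_dist_lt hlt (hball (mem_ball_self hr))
    rw [← mem_ball'] at hcz
    have h1 := (hdisj t ht u hu hne ⟨hball hcz, hz⟩).1
    have h2 : z ∈ interior (t.1 : Set (E d)) := interior_maximal hball isOpen_ball hcz
    exact h1.2 h2
  · intro t ht y hy z hz
    obtain ⟨a, ha, x, hx⟩ := hTA t ht
    rw [← SetLike.mem_coe, hx] at hy hz
    obtain ⟨y, hy, rfl⟩ := hy
    obtain ⟨z, hz, rfl⟩ := hz
    rw [dist_add_right]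
    exact hD (mem_biUnion ha hy) (mem_biUnion ha hz)
  · intro x
    have hx : x ∈ ⋃ t ∈ T.tiles, (t.1 : Set (E d)) := hcov ▸ mem_univ x
    obtain ⟨t, ht, hxt⟩ := mem_iUnion₂.1 hx
    exact ⟨t, ht, x, hxt, mem_ball_self one_pos⟩

theorem IsDelone.exists_isRegular {T : Pattern d X} (hT : T.IsDelone) :
    ∃ r > 0, ∃ D, T.IsRegular r D ∧ ∃ ρ > 0, ∀ x, (T.patch x ρ).tiles.Nonempty := by
  obtain ⟨D, l, hD⟩ := hT
  refine ⟨D.packingRadius, D.packingRadius_pos, 0, ⟨?_, ?_⟩, D.coveringRadius + 1,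
    by positivity, ?_⟩
  · rw [hD]
    rintro _ ⟨x, rfl⟩ _ ⟨y, rfl⟩ hne
    have hxy : (x : E d) ≠ y := fun h => hne (by rw [Subtype.ext h])
    exact (D.packingRadius_lt_dist_of_mem_ne x.2 y.2 hxy).le.trans_eq
      (NonemptyCompacts.isometry_singleton.dist_eq (x : E d) y).symm
  · rw [hD]
    rintro _ ⟨x, rfl⟩ y hy z hz
    rw [NonemptyCompacts.mem_singleton] at hy hz
    rw [hy, hz, dist_self]
  · intro x
    obtain ⟨y, hy, hxy⟩ := D.exists_dist_le_coveringRadius x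
    refine ⟨({y}, l ⟨y, hy⟩), hD ▸ ⟨⟨y, hy⟩, rfl⟩, y,
      (NonemptyCompacts.mem_singleton _ _).2 rfl, ?_⟩
    rw [mem_ball, dist_comm]
    linarith

end Pattern

/-! ### Tiling spaces as dynamical systems -/

variable {d : ℕ} {X X' : Type*} [MetricSpace X] [MetricSpace X']

/-- Regularity is translation invariant and closed, so it passes to the hull. The unit added to `ρ`
absorbs the motion of a tile in the approximation. -/
theorem TilingSpace.exists_isRegular (Ω : TilingSpace d X) :
    ∃ r > 0, ∃ D, ∃ ρ > 0, ∀ T ∈ Ω.carrier, T.IsRegular r D ∧ (T.patch 0 ρ).tiles.Nonempty := by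
  obtain ⟨T₀, h₀, hΩ⟩ := Ω.is_hull
  obtain ⟨r, hr, D, hreg, ρ, hρ, hne⟩ := h₀.elim (fun h => h.exists_isRegular)
    fun h => h.exists_isRegular
  refine ⟨r, hr, D, ρ + 1, by positivity, fun T hT => ⟨?_, ?_⟩⟩
  · rw [hΩ] at hT
    refine closure_minimal ?_ (Pattern.isClosed_setOf_isRegular r D) hT
    rintro _ ⟨x, rfl⟩
    exact hreg.shift x
  · rw [hΩ, Pattern.mem_closure_iff_close] at hT
    have hε : 0 < min 1 ρ⁻¹ := by positivity
    obtain ⟨_, ⟨x, rfl⟩, M, h1, h2, h3, h4⟩ := hT _ hε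
    obtain ⟨u, hu, hm⟩ : ((T₀.shift x).patch 0 ρ).tiles.Nonempty := by
      rw [Pattern.patch_shift]
      exact (hne _).image _
    have hle : ρ ≤ (min 1 ρ⁻¹)⁻¹ := by
      rw [le_inv_comm₀ hρ hε]; exact min_le_right _ _
    obtain ⟨t, m⟩ := h4 u ⟨hu, hm.mono (inter_subset_inter_right _ (ball_subset_ball hle))⟩
    obtain ⟨ht, -, htu⟩ := h1 _ _ m
    rw [dist_comm] at htu
    exact ⟨t, ht, Pattern.meets_of_dist_lt (htu.trans_le (min_le_left _ _)) hm⟩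

instance TilingSpace.instCompactSpace [CompactSpace X] (Ω : TilingSpace d X) : CompactSpace Ω := by
  obtain ⟨r, hr, D, _, _, h⟩ := Ω.exists_isRegular
  rw [← isCompact_iff_compactSpace]
  obtain ⟨T₀, -, hΩ⟩ := Ω.is_hull
  exact (Pattern.isCompact_setOf_isRegular hr D).of_isClosed_subset (hΩ ▸ isClosed_closure)
    fun T hT => (h T hT).1

theorem TilingSpace.uniformity_hasBasis (Ω : TilingSpace d X) :
    (uniformity Ω).HasBasis (fun ε : ℝ => 0 < ε) fun ε => {p | Pattern.Close ε p.1.1 p.2.1} := by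
  rw [uniformity_subtype]
  exact Pattern.uniformity_hasBasis.comap _

instance TilingSpace.instT2Space (Ω : TilingSpace d X) : T2Space Ω := by
  obtain ⟨r, hr, D, _, _, h⟩ := Ω.exists_isRegular
  have : T0Space Ω := by
    rw [t0Space_iff_uniformity]
    intro T T' H
    refine Subtype.ext ((h T T.2).1.eq_of_forall_close hr (h T' T'.2).1 fun ε hε => ?_)
    exact H _ (Ω.uniformity_hasBasis.mem_of_mem hε)
  infer_instance

section

variable {Ω : TilingSpace d X}

theorem tmove_zero (T : Ω) : tmove T 0 = T := Subtype.ext (Pattern.shift_zero _)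

theorem tmove_tmove (T : Ω) (x y : E d) : tmove (tmove T x) y = tmove T (x + y) :=
  Subtype.ext (Pattern.shift_shift _ _ _)

/-- Aperiodicity enters here: displacements within an orbit are unique, so a map has at most one
cocycle. -/
theorem tmove_injective (T : Ω) : Function.Injective (tmove T) := by
  intro x y h
  have h1 : tmove (tmove T x) (y - x) = tmove T x := by
    rw [tmove_tmove, add_sub_cancel, h]
  exact (sub_eq_zero.1 (Ω.aperiodic _ (tmove T x).2 _ (congrArg Subtype.val h1))).symm

theorem continuous_tmove : Continuous fun p : Ω × E d => tmove p.1 p.2 :=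
  Continuous.subtype_mk (Pattern.continuous_shift_uncurry.comp
    ((continuous_subtype_val.comp continuous_fst).prodMk continuous_snd)) _

theorem Continuous.tmove {Y : Type*} [TopologicalSpace Y] {f : Y → Ω} {g : Y → E d}
    (hf : Continuous f) (hg : Continuous g) : Continuous fun y => tmove (f y) (g y) :=
  continuous_tmove.comp (hf.prodMk hg)

theorem eq_univ_of_isClosed_of_tmove_mem {S : Set Ω} (hc : IsClosed S) {T : Ω}
    (hT : ∀ x, tmove T x ∈ S) : S = univ := by
  refine eq_univ_of_forall fun T' => ?_
  rw [← hc.closure_eq]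
  refine closure_mono (range_subset_iff.2 hT) ?_
  rw [closure_subtype]
  convert Ω.minimal T.1 T.2 T'.2 using 2
  rw [← range_comp]
  rfl

/-! ### Patches -/

theorem SamePatch.symm {R : ℝ} {T T' : Ω} (h : SamePatch R T T') : SamePatch R T' T := Eq.symm h

theorem SamePatch.trans {R : ℝ} {T T' T'' : Ω} (h : SamePatch R T T') (h' : SamePatch R T' T'') :
    SamePatch R T T'' := Eq.trans h h'

theorem samePatch_iff {R : ℝ} {T T' : Ω} : SamePatch R T T' ↔
    ∀ t : Tile d X, ((t.1 : Set (E d)) ∩ ball 0 R).Nonempty →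
      (t ∈ T.1.tiles ↔ t ∈ T'.1.tiles) := by
  unfold SamePatch
  rw [Pattern.ext_iff, Set.ext_iff]
  refine forall_congr' fun t => ⟨fun h hm => ?_, fun h => ?_⟩
  · exact ⟨fun ht => (h.1 ⟨ht, hm⟩).1, fun ht => (h.2 ⟨ht, hm⟩).1⟩
  · exact ⟨fun ht => ⟨(h ht.2).1 ht.1, ht.2⟩, fun ht => ⟨(h ht.2).2 ht.1, ht.2⟩⟩

theorem samePatch_tmove_iff {R : ℝ} {T T' : Ω} {v : E d} : SamePatch R (tmove T v) (tmove T' v) ↔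
    ∀ t : Tile d X, ((t.1 : Set (E d)) ∩ ball v R).Nonempty →
      (t ∈ T.1.tiles ↔ t ∈ T'.1.tiles) := by
  rw [samePatch_iff]
  constructor
  · intro h t ht
    rw [← Pattern.shift_mem_shift (T := T.1) (x := v),
      ← Pattern.shift_mem_shift (T := T'.1) (x := v)]
    exact h _ (Tile.meets_shift.2 (by rwa [zero_add]))
  · intro h t ht
    change t ∈ (T.1.shift v).tiles ↔ t ∈ (T'.1.shift v).tiles
    rw [Pattern.mem_shift, Pattern.mem_shift]
    refine h _ (Tile.meets_shift.2 ?_)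
    rwa [add_neg_cancel]

theorem SamePatch.tmove {R R' : ℝ} {T T' : Ω} (h : SamePatch R T T') {v : E d}
    (hv : ‖v‖ + R' ≤ R) : SamePatch R' (tmove T v) (tmove T' v) := by
  rw [samePatch_iff] at h
  rw [samePatch_tmove_iff]
  refine fun t ht => h t (ht.mono (inter_subset_inter_right _ (ball_subset_ball' ?_)))
  rw [dist_zero_right]
  linarith

/-- Two patterns with the same patches around many points have the same large patch. -/
theorem SamePatch.of_forall_ball {r r₁ : ℝ} {T T' : Ω}
    (h : ∀ p ∈ ball (0 : E d) r, ∃ a, ‖p - a‖ < r₁ ∧ SamePatch r₁ (TilingClassification.tmove T a)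
      (TilingClassification.tmove T' a)) :
    SamePatch r T T' := by
  rw [samePatch_iff]
  rintro t ⟨p, hpt, hp⟩
  obtain ⟨a, ha, hs⟩ := h p hp
  exact samePatch_tmove_iff.1 hs t ⟨p, hpt, by rwa [mem_ball, dist_eq_norm]⟩

/-- Small translations change patches. -/
theorem TilingSpace.exists_rigid (Ω : TilingSpace d X) : ∃ r > 0, ∃ R > 0,
    ∀ (T : Ω) (x y : E d), ‖x - y‖ < r → SamePatch R (tmove T x) (tmove T y) → x = y := by
  obtain ⟨r, hr, D, ρ, hρ, h⟩ := Ω.exists_isRegular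
  refine ⟨r, hr, ρ, hρ, fun T x y hxy hs => ?_⟩
  obtain ⟨hreg, u, hu, hm⟩ := h _ (tmove T x).2
  -- A common tile `u` of `T - x` and `T - y` gives the tiles `u + x` and `u + y` of `T`, less than
  -- `r` apart and hence equal.
  have hu' : u ∈ (T.1.shift y).tiles := (samePatch_iff.1 hs u hm).1 hu
  change u ∈ (T.1.shift x).tiles at hu
  rw [Pattern.mem_shift] at hu hu'
  have hd : dist (Tile.shift (-x) u) (Tile.shift (-y) u) < r := by
    refine (Tile.dist_shift_shift_le _ _ _).trans_lt ?_
    rwa [neg_sub_neg, norm_sub_rev]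
  have hEq := (h T T.2).1.eq_of_dist_lt hu hu' hd
  have : Tile.shift (x - y) u = u := by
    have := congrArg (Tile.shift x) hEq
    rw [Tile.shift_add, Tile.shift_add, neg_add_cancel, Tile.shift_zero] at this
    rw [sub_eq_neg_add]
    exact this.symm
  exact sub_eq_zero.1 (Tile.shift_eq_self this)

/-- The identity correspondence on the common patch of radius `1/ε` shows `ε`-closeness. -/
theorem TilingSpace.exists_samePatch_imp_mem (Ω : TilingSpace d X) {U : Set (Ω × Ω)}
    (hU : U ∈ uniformity Ω) : ∃ R > 0, ∀ T T' : Ω, SamePatch R T T' → (T, T') ∈ U := by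
  obtain ⟨ε, hε, hεU⟩ := Ω.uniformity_hasBasis.mem_iff.1 hU
  refine ⟨ε⁻¹, inv_pos.2 hε, fun T T' h => hεU ?_⟩
  refine ⟨fun t u => t ∈ (T.1.patch 0 ε⁻¹).tiles ∧ t = u, ?_, ?_, ?_, ?_⟩
  · rintro t _ ⟨ht, rfl⟩
    refine ⟨ht.1, ?_, by rwa [dist_self]⟩
    rw [h] at ht
    exact ht.1
  · rintro t _ t' _ ⟨-, rfl⟩ ⟨-, rfl⟩
    rfl
  · exact fun t ht => ⟨t, ht, rfl⟩
  · exact fun t ht => ⟨t, h ▸ ht, rfl⟩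

end

/-! ### Finite local complexity -/

/-- If a finite set of tiles is approximately contained in a translate of another one, then it is
contained in a nearby translate. -/
theorem eventually_exists_shift {P Q : Set (Tile d X)} (hP : P.Finite) (hQ : Q.Finite) {ε : ℝ}
    (hε : 0 < ε) : ∀ᶠ η in 𝓝[>] (0 : ℝ), ∀ w : E d,
      (∀ p ∈ P, ∃ q ∈ Q, dist p (Tile.shift w q) < η) →
      ∃ w₀, ‖w - w₀‖ < ε ∧ ∀ p ∈ P, ∃ q ∈ Q, p = Tile.shift w₀ q := by
  suffices ∃ η > 0, ∀ w : E d, (∀ p ∈ P, ∃ q ∈ Q, dist p (Tile.shift w q) < η) →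
      ∃ w₀, ‖w - w₀‖ < ε ∧ ∀ p ∈ P, ∃ q ∈ Q, p = Tile.shift w₀ q by
    obtain ⟨η, hη, H⟩ := this
    filter_upwards [Ioo_mem_nhdsGT hη] with η' hη' w hw
    refine H w fun p hp => ?_
    obtain ⟨q, hq, h⟩ := hw p hp
    exact ⟨q, hq, h.trans hη'.2⟩
  rcases P.eq_empty_or_nonempty with rfl | ⟨p₀, hp₀⟩
  · exact ⟨1, one_pos, fun w _ => ⟨w, by simpa using hε, by simp⟩⟩
  -- Translations `w n` with error `1/(n+1)` are bounded, since they bring a tile of the finite set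
  -- `Q` near `p₀`. A limit of them is an exact solution because the translates of `Q` are closed.
  by_contra! H
  choose w hw hno using fun n : ℕ => H (1 / ((n : ℝ) + 1)) Nat.one_div_pos_of_nat
  obtain ⟨C, hC⟩ := ((Bornology.isBounded_biUnion hQ).2
    fun q _ => q.1.isCompact.isBounded).exists_norm_le
  obtain ⟨y, hy⟩ := p₀.1.nonempty
  have hbd : ∀ n, w n ∈ closedBall (0 : E d) (C + ‖y‖ + 1) := by
    intro n
    obtain ⟨q, hq, hd⟩ := hw n p₀ hp₀
    obtain ⟨z, hz, hyz⟩ := Tile.exists_dist_lt ((Tile.dist_fst_le _ _).trans_lt hd) hy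
    have h1 : ‖z + w n‖ ≤ C := hC _ (mem_biUnion hq (Tile.mem_shift.1 hz))
    have h2 : dist y z < 1 := hyz.trans_le (by
      rw [div_le_one (by positivity)]; linarith [(Nat.cast_nonneg n : (0 : ℝ) ≤ n)])
    rw [dist_eq_norm] at h2
    rw [mem_closedBall_zero_iff]
    have h3 : w n = (z + w n) + (y - z) - y := by abel
    have h4 := norm_sub_le ((z + w n) + (y - z)) y
    rw [← h3] at h4
    linarith [norm_add_le (z + w n) (y - z)]
  obtain ⟨w₀, -, φ, hφ, hlim⟩ := tendsto_subseq_of_bounded isBounded_closedBall hbd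
  have hw₀ : ∀ p ∈ P, ∃ q ∈ Q, p = Tile.shift w₀ q := by
    intro p hp
    have hcl : IsClosed (Tile.shift w₀ '' Q) := (hQ.image _).isClosed
    suffices p ∈ Tile.shift w₀ '' Q by
      obtain ⟨q, hq, h⟩ := this
      exact ⟨q, hq, h.symm⟩
    rw [← hcl.closure_eq, Metric.mem_closure_iff]
    intro δ hδ
    have h1 : ∀ᶠ n in atTop, dist (w (φ n)) w₀ < δ / 2 :=
      (Metric.tendsto_nhds.1 hlim) _ (half_pos hδ)
    have h2 : ∀ᶠ n in atTop, 1 / (((φ n : ℕ) : ℝ) + 1) < δ / 2 :=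
      (tendsto_one_div_add_atTop_nhds_zero_nat.comp hφ.tendsto_atTop).eventually
        (gt_mem_nhds (half_pos hδ))
    obtain ⟨n, hn1, hn2⟩ := (h1.and h2).exists
    obtain ⟨q, hq, hd⟩ := hw (φ n) p hp
    refine ⟨_, ⟨q, hq, rfl⟩, ?_⟩
    have := Tile.dist_shift_shift_le (w (φ n)) w₀ q
    rw [← dist_eq_norm] at this
    linarith [dist_triangle p (Tile.shift (w (φ n)) q) (Tile.shift w₀ q)]
  obtain ⟨n, hn⟩ := ((Metric.tendsto_nhds.1 hlim) _ hε).exists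
  obtain ⟨p, hp, h⟩ := hno (φ n) w₀ (by rwa [← dist_eq_norm])
  obtain ⟨q, hq, h'⟩ := hw₀ p hp
  exact h q hq h'

/-- FLC leaves finitely many pairs of patch types, so one `η` serves for all of them in
`eventually_exists_shift`. The radius `R + 1` catches the tiles matched with those meeting `B(0,
R)`. -/
theorem TilingSpace.FLC.exists_shift_mem [CompactSpace X] {Ω : TilingSpace d X} (hΩ : Ω.FLC)
    {R ε : ℝ} (hR : 0 < R) (hε : 0 < ε) : ∃ η > 0, ∀ T ∈ Ω.carrier, ∀ T' ∈ Ω.carrier, Pattern.Close η T T' →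
      ∃ z : E d, ‖z‖ < ε ∧ ∀ t ∈ (T.patch 0 R).tiles, Tile.shift z t ∈ T'.tiles := by
  obtain ⟨r, hr, D, _, _, hreg⟩ := Ω.exists_isRegular
  obtain ⟨F, hF, HF⟩ := hΩ R hR
  obtain ⟨F', hF', HF'⟩ := hΩ (R + 1) (by positivity)
  have key : ∀ᶠ η in 𝓝[>] (0 : ℝ), ∀ P ∈ F, ∀ P' ∈ F', P.tiles.Finite → P'.tiles.Finite →
      ∀ w : E d, (∀ p ∈ P.tiles, ∃ q ∈ P'.tiles, dist p (Tile.shift w q) < η) →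
        ∃ w₀, ‖w - w₀‖ < ε ∧ ∀ p ∈ P.tiles, ∃ q ∈ P'.tiles, p = Tile.shift w₀ q := by
    refine (eventually_all_finite hF).2 fun P _ => (eventually_all_finite hF').2 fun P' _ => ?_
    by_cases h1 : P.tiles.Finite
    · by_cases h2 : P'.tiles.Finite
      · filter_upwards [eventually_exists_shift h1 h2 hε] with η hη _ _
        exact hη
      · exact Eventually.of_forall fun _ _ h => absurd h h2
    · exact Eventually.of_forall fun _ h => absurd h h1
  obtain ⟨η, hη, hη0, hη1⟩ := (key.and (Ioo_mem_nhdsGT (show 0 < min 1 R⁻¹ by positivity))).exists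
  have hηR : R ≤ η⁻¹ := by
    rw [le_inv_comm₀ hR hη0]; exact hη1.le.trans (min_le_right _ _)
  refine ⟨η, hη0, fun T hT T' hT' ⟨M, m1, m2, m3, m4⟩ => ?_⟩
  obtain ⟨P, hP, y, hPy⟩ := HF T hT 0
  obtain ⟨P', hP', y', hPy'⟩ := HF' T' hT' 0
  have fin : ∀ {S Q : Pattern d X} {ρ : ℝ} {z : E d}, S ∈ Ω.carrier → S.patch 0 ρ = Q.shift z →
      Q.tiles.Finite := by
    intro S Q ρ z hS h
    have := (hreg S hS).1.finite_patch hr ρ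
    rw [h] at this
    exact Finite.of_finite_image this (Pattern.shift_injective z).injOn
  obtain ⟨w₀, hw, H⟩ := hη P hP P' hP' (fin hT hPy) (fin hT' hPy') (y' - y) (by
    intro p hp
    have hp' : Tile.shift y p ∈ (T.patch 0 R).tiles := by
      rw [hPy]; exact ⟨p, hp, rfl⟩
    obtain ⟨u, m⟩ := m3 _ ⟨hp'.1, hp'.2.mono (inter_subset_inter_right _ (ball_subset_ball hηR))⟩
    obtain ⟨-, hu, hd⟩ := m1 _ _ m
    have hu' : u ∈ (T'.patch 0 (R + 1)).tiles :=
      ⟨hu, Pattern.meets_of_dist_lt (hd.trans (hη1.trans_le (min_le_left _ _))) hp'.2⟩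
    rw [hPy'] at hu'
    obtain ⟨q, hq, rfl⟩ := hu'
    refine ⟨q, hq, ?_⟩
    rw [← Pattern.dist_shift y, Tile.shift_add, sub_add_cancel]
    exact hd)
  refine ⟨_, hw, fun t ht => ?_⟩
  rw [hPy] at ht
  obtain ⟨p, hp, rfl⟩ := ht
  obtain ⟨q, hq, rfl⟩ := H p hp
  have : Tile.shift y' q ∈ (T'.patch 0 (R + 1)).tiles := by
    rw [hPy']; exact ⟨q, hq, rfl⟩
  rw [Tile.shift_add, Tile.shift_add]
  convert this.1 using 2
  abel

/-- In an FLC space, close patterns agree on a large ball up to a small translation. -/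
theorem TilingSpace.FLC.exists_samePatch_tmove [CompactSpace X] {Ω : TilingSpace d X} (hΩ : Ω.FLC)
    (R : ℝ) {ε : ℝ} (hε : 0 < ε) : ∃ U ∈ uniformity Ω, ∀ T T' : Ω, (T, T') ∈ U →
      ∃ z : E d, ‖z‖ < ε ∧ SamePatch R T (tmove T' z) := by
  obtain ⟨r, hr, D, ρ, hρ, hreg⟩ := Ω.exists_isRegular
  obtain ⟨δ, hδ, hδε, hδr, hδ1⟩ : ∃ δ > 0, δ ≤ ε ∧ δ ≤ r / 2 ∧ δ ≤ 1 :=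
    ⟨min ε (min (r / 2) 1), by positivity, by simp⟩
  obtain ⟨η, hη, H⟩ := hΩ.exists_shift_mem (R := max R ρ + 1) (by positivity) hδ
  refine ⟨_, Ω.uniformity_hasBasis.mem_of_mem hη, fun T T' hc => ?_⟩
  obtain ⟨z, hz, h1⟩ := H T T.2 T' T'.2 hc
  obtain ⟨z', hz', h2⟩ := H T' T'.2 T T.2 hc.symm
  have meet : ∀ {t : Tile d X} {s : ℝ}, s ≤ max R ρ → ((t.1 : Set (E d)) ∩ ball 0 s).Nonempty →
      (((Tile.shift z t).1 : Set (E d)) ∩ ball 0 (max R ρ + 1)).Nonempty := by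
    intro t s hs ht
    rw [Tile.meets_shift]
    refine ht.mono (inter_subset_inter_right _ (ball_subset_ball' ?_))
    rw [zero_add, dist_zero_left]
    linarith
  -- Moving a tile of `T` to `T'` and back yields a tile of `T` less than `r` away, hence the same
  -- tile. So the two shifts are inverse and the inclusions become an equality of patches.
  have hzz : z + z' = 0 := by
    obtain ⟨hT, u, hu, hm⟩ := hreg T T.2
    have h3 := h1 u ⟨hu, hm.mono (inter_subset_inter_right _
      (ball_subset_ball (by linarith [le_max_right R ρ])))⟩
    have h4 := h2 _ ⟨h3, meet (le_max_right _ _) hm⟩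
    rw [Tile.shift_add] at h4
    refine Tile.shift_eq_self (hT.eq_of_dist_lt h4 hu ?_)
    linarith [Tile.dist_shift_self_le (z + z') u, norm_add_le z z']
  obtain rfl : z' = -z := (neg_eq_of_add_eq_zero_right hzz).symm
  refine ⟨-z, by rw [norm_neg]; linarith, samePatch_iff.2 fun t ht => ?_⟩
  change t ∈ T.1.tiles ↔ t ∈ (T'.1.shift (-z)).tiles
  rw [Pattern.mem_shift, neg_neg]
  constructor
  · intro h
    exact h1 t ⟨h, ht.mono (inter_subset_inter_right _
      (ball_subset_ball (by linarith [le_max_left R ρ])))⟩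
  · intro h
    have := h2 _ ⟨h, meet (le_max_left _ _) ht⟩
    rwa [Tile.shift_add, add_neg_cancel, Tile.shift_zero] at this

end TilingClassification

namespace TilingClassification

/-! ### Cocycles of orbit equivalences -/

/-- A locally connected, locally compact Hausdorff space has no countable partition into closed
sets other than the partitions into clopen sets. -/
theorem isLocallyConstant_of_isClosed_fiber {Y ι : Type*} [TopologicalSpace Y]
    [LocallyConnectedSpace Y] [LocallyCompactSpace Y] [T2Space Y] [Countable ι] (c : Y → ι)
    (hc : ∀ i, IsClosed (c ⁻¹' {i})) : IsLocallyConstant c := by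
  set B : Set Y := (⋃ i, interior (c ⁻¹' {i}))ᶜ with hB
  have hBc : IsClosed B := (isOpen_iUnion fun _ => isOpen_interior).isClosed_compl
  have mem_int : ∀ y ∉ B, y ∈ interior (c ⁻¹' {c y}) := by
    intro y hy
    rw [hB, notMem_compl_iff] at hy
    obtain ⟨j, hj⟩ := mem_iUnion.1 hy
    have hyj : y ∈ c ⁻¹' {j} := interior_subset hj
    rwa [mem_singleton_iff.1 hyj]
  suffices hBe : B = ∅ by
    rw [IsLocallyConstant.iff_isOpen_fiber]
    intro i
    rw [← subset_interior_iff_isOpen]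
    intro y hy
    obtain rfl : c y = i := hy
    exact mem_int y (by simp [hBe])
  -- By Baire's theorem, `c` has a constant value `i` on `B ∩ O` for some open `O` meeting `B`. On
  -- the component of `b` in `O`, any other value would be taken on a relatively clopen set, so `c =
  -- i` there and `b` is not in `B`.
  by_contra hne
  have : Nonempty B := (nonempty_iff_ne_empty.2 hne).to_subtype
  have : LocallyCompactSpace B := hBc.locallyCompactSpace
  obtain ⟨i, b, hb⟩ := nonempty_interior_of_iUnion_of_closed
    (f := fun i => (Subtype.val ⁻¹' (c ⁻¹' {i}) : Set B))
    (fun i => (hc i).preimage continuous_subtype_val)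
    (eq_univ_of_forall fun b => mem_iUnion.2 ⟨c b, rfl⟩)
  obtain ⟨O, hO, hOB⟩ := isOpen_induced_iff.1
    (isOpen_interior (s := (Subtype.val ⁻¹' (c ⁻¹' {i}) : Set B)))
  have hOi : ∀ y ∈ O, y ∈ B → c y = i := fun y hy hyB =>
    interior_subset (s := (Subtype.val ⁻¹' (c ⁻¹' {i}) : Set B))
      (hOB ▸ hy : (⟨y, hyB⟩ : B) ∈ interior _)
  have hbO : (b : Y) ∈ O := by
    have : b ∈ Subtype.val ⁻¹' O := hOB ▸ hb
    exact this
  have hJ : connectedComponentIn O b ⊆ c ⁻¹' {i} := by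
    intro y hy
    by_contra hyi
    obtain ⟨z, -, hz1, hz2⟩ := isPreconnected_connectedComponentIn (F := O) (x := (b : Y))
      (interior (c ⁻¹' {c y})) (c ⁻¹' {c y})ᶜ isOpen_interior (hc _).isOpen_compl
      (by
        intro z hz
        by_cases h : c z = c y
        · left
          rw [← h]
          exact mem_int z fun hzB => hyi
            (h.symm.trans (hOi z (connectedComponentIn_subset O b hz) hzB))
        · exact Or.inr h)
      ⟨y, hy, mem_int y fun hyB => hyi (hOi y (connectedComponentIn_subset O b hy) hyB)⟩
      ⟨b, mem_connectedComponentIn hbO, fun h => hyi ((Eq.symm h).trans (hOi b hbO b.2))⟩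
    exact hz2 (interior_subset hz1)
  exact b.2 (mem_iUnion.2 ⟨i, interior_maximal hJ hO.connectedComponentIn
    (mem_connectedComponentIn hbO)⟩)

variable {d : ℕ} {X X' : Type*} [MetricSpace X'] [MetricSpace X]

/-- Points do not return close to themselves under translations of bounded size that are not
small. -/
theorem TilingSpace.exists_no_return [CompactSpace X] (Ω : TilingSpace d X) {a : ℝ} (ha : 0 < a)
    (b : ℝ) : ∃ U ∈ uniformity Ω, ∀ (S : Ω) (v : E d), a ≤ ‖v‖ → ‖v‖ ≤ b → (S, tmove S v) ∉ U := by
  have hK : IsCompact {v : E d | a ≤ ‖v‖ ∧ ‖v‖ ≤ b} := by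
    refine (isCompact_closedBall (0 : E d) b).of_isClosed_subset ?_ fun v hv => by simpa using hv.2
    exact (isClosed_le continuous_const continuous_norm).inter
      (isClosed_le continuous_norm continuous_const)
  have hc : Continuous fun p : Ω × E d => (p.1, tmove p.1 p.2) :=
    continuous_fst.prodMk continuous_tmove
  -- This compact set of pairs misses the diagonal by aperiodicity, so its complement is an
  -- entourage.
  have hI := ((isCompact_univ (X := Ω)).prod hK).image hc
  refine ⟨((fun p : Ω × E d => (p.1, tmove p.1 p.2)) ''
    (univ ×ˢ {v : E d | a ≤ ‖v‖ ∧ ‖v‖ ≤ b}))ᶜ, ?_,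
    fun S v h1 h2 hmem => hmem ⟨(S, v), ⟨mem_univ _, h1, h2⟩, rfl⟩⟩
  rw [← nhdsSet_diagonal_eq_uniformity, hI.isClosed.isOpen_compl.mem_nhdsSet]
  rintro ⟨S, S'⟩ hS ⟨⟨T, v⟩, ⟨-, hv, -⟩, h⟩
  obtain rfl : S = S' := hS
  rw [Prod.mk.injEq] at h
  obtain ⟨rfl, h⟩ := h
  have : v = 0 := tmove_injective T (by rw [h, tmove_zero])
  rw [this, norm_zero] at hv
  linarith

/-- A map into an orbit that is continuous for the topology of the tiling space is continuous for
the topology of the orbit. -/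
theorem continuous_of_continuous_tmove [CompactSpace X] {Ω : TilingSpace d X} {S : Ω}
    {g : E d → E d} (hg : Continuous fun x => tmove S (g x)) : Continuous g := by
  rw [continuous_iff_continuousAt]
  intro x₀
  rw [ContinuousAt, Metric.tendsto_nhds]
  intro a ha
  obtain ⟨U, hU, hno⟩ := Ω.exists_no_return ha (2 * a)
  obtain ⟨V, hV, hVs, hVU⟩ := comp_symm_mem_uniformity_sets hU
  have hW : {x | (tmove S (g x₀), tmove S (g x)) ∈ V} ∈ 𝓝 x₀ :=
    Uniform.tendsto_nhds_right.1 (hg.tendsto x₀) hV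
  obtain ⟨W, hWV, hWo, hxW⟩ := _root_.mem_nhds_iff.1 hW
  -- Distances between values of `g` on `W` avoid `[a, 2a]`, so being less than `a` apart is an
  -- equivalence relation.
  have gap : ∀ x ∈ W, ∀ y ∈ W, dist (g x) (g y) ≤ 2 * a → dist (g x) (g y) < a := by
    intro x hx y hy h
    by_contra! hle
    rw [dist_comm, dist_eq_norm] at h hle
    refine hno (tmove S (g x)) _ hle h (hVU ?_)
    rw [tmove_tmove, add_sub_cancel]
    exact ⟨_, hVs.symm _ _ (hWV hx), hWV hy⟩
  let s : Setoid W :=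
    { r := fun x y => dist (g x) (g y) < a
      iseqv :=
        { refl := fun x => by rwa [dist_self]
          symm := fun {x y} h => by rwa [dist_comm]
          trans := fun {x y z} h h' => gap x x.2 z z.2
            (by linarith [dist_triangle (g x) (g y) (g z)]) } }
  have : LocallyConnectedSpace W := hWo.locallyConnectedSpace
  have : LocallyCompactSpace W := hWo.locallyCompactSpace
  -- Separability of `ℝ^d` bounds the number of classes. Each class is closed, as the preimage of
  -- the compact image of a closed ball, so the partition is locally constant.
  have : Countable (Quotient s) := by
    let q := denseSeq (E d)
    let f : {n : ℕ // ∃ x : W, dist (g x) (q n) < a / 2} → Quotient s := fun n => ⟦n.2.choose⟧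
    have hf : Function.Surjective f := by
      intro i
      induction i using Quotient.inductionOn with
      | h x =>
        obtain ⟨n, hn⟩ := (denseRange_denseSeq (E d)).exists_dist_lt (g x) (half_pos ha)
        have hex : ∃ x : W, dist (g x) (q n) < a / 2 := ⟨x, hn⟩
        refine ⟨⟨n, hex⟩, Quotient.sound ?_⟩
        have h1 := hex.choose_spec
        change dist (g hex.choose) (g x) < a
        linarith [dist_triangle_right (g hex.choose) (g x) (q n)]
    exact hf.countable
  have hloc : IsLocallyConstant (fun x : W => (⟦x⟧ : Quotient s)) := by
    refine isLocallyConstant_of_isClosed_fiber _ fun i => ?_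
    induction i using Quotient.inductionOn with
    | h y =>
      have hcl : IsClosed (tmove S '' closedBall (g y) a) :=
        ((isCompact_closedBall _ _).image
          (Continuous.tmove continuous_const continuous_id)).isClosed
      convert hcl.preimage (hg.comp continuous_subtype_val) using 1
      ext x
      simp only [mem_preimage, mem_singleton_iff, Function.comp_apply,
        (tmove_injective S).mem_set_image, mem_closedBall]
      rw [Quotient.eq]
      change dist (g x) (g y) < a ↔ _
      exact ⟨le_of_lt, fun h => gap x x.2 y y.2 (by linarith)⟩
  have hopen := hloc.isOpen_fiber ⟦⟨x₀, hxW⟩⟧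
  have := (hWo.isOpenMap_subtype_val _ hopen).mem_nhds ⟨⟨x₀, hxW⟩, rfl, rfl⟩
  filter_upwards [this]
  rintro _ ⟨x, hx, rfl⟩
  exact Quotient.exact hx

section

variable {Ω : TilingSpace d X} {Ω' : TilingSpace d X'}

theorem IsCocycleOf.map_add {h : Ω → Ω'} {α : Ω → E d → E d} (hα : IsCocycleOf h α) (T : Ω)
    (v w : E d) : α T v + α (tmove T v) w = α T (v + w) := by
  apply tmove_injective (h T)
  rw [← tmove_tmove, ← hα, ← hα, tmove_tmove, hα]

theorem IsCocycleOf.map_zero {h : Ω → Ω'} {α : Ω → E d → E d} (hα : IsCocycleOf h α) (T : Ω) :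
    α T 0 = 0 := by
  apply tmove_injective (h T)
  rw [← hα, tmove_zero, tmove_zero]

theorem IsCocycleOf.unique {h : Ω → Ω'} {α β : Ω → E d → E d} (hα : IsCocycleOf h α)
    (hβ : IsCocycleOf h β) : α = β := by
  funext T v
  apply tmove_injective (h T)
  rw [← hα, ← hβ]

theorem IsCocycleOf.continuous_apply [CompactSpace X'] {h : Ω → Ω'} (hc : Continuous h)
    {α : Ω → E d → E d} (hα : IsCocycleOf h α) (T : Ω) : Continuous (α T) := by
  refine continuous_of_continuous_tmove (S := h T) ?_
  simp_rw [← hα T]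
  exact hc.comp (Continuous.tmove continuous_const continuous_id)

theorem exists_uniform_nhds_zero [CompactSpace X] {U : Set (Ω × Ω)} (hU : U ∈ uniformity Ω) :
    ∃ δ > 0, ∀ (T : Ω) (v : E d), ‖v‖ < δ → (T, tmove T v) ∈ U := by
  have : ∀ᶠ v in 𝓝 (0 : E d), ∀ T ∈ (univ : Set Ω), (T, tmove T v) ∈ U := by
    refine isCompact_univ.eventually_forall_of_forall_eventually fun T _ => ?_
    have hc : Continuous fun p : E d × Ω => (p.2, tmove p.2 p.1) :=
      continuous_snd.prodMk (Continuous.tmove continuous_snd continuous_fst)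
    refine (hc.tendsto (0, T)).eventually ?_
    simp only [tmove_zero]
    exact nhds_le_uniformity T hU
  obtain ⟨δ, hδ, H⟩ := Metric.eventually_nhds_iff.1 this
  exact ⟨δ, hδ, fun T v hv => H (by simpa using hv) T (mem_univ T)⟩

/-- If `‖α T v‖` reached `a`, it would equal `a` somewhere on the segment-connected ball of small
vectors, giving a forbidden close return. -/
theorem IsCocycleOf.exists_norm_lt [CompactSpace X] [CompactSpace X'] {h : Ω → Ω'}
    (hc : Continuous h) {α : Ω → E d → E d} (hα : IsCocycleOf h α) {a : ℝ} (ha : 0 < a) :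
    ∃ δ > 0, ∀ T v, ‖v‖ < δ → ‖α T v‖ < a := by
  obtain ⟨U, hU, hno⟩ := Ω'.exists_no_return ha a
  have huc := CompactSpace.uniformContinuous_of_continuous hc
  obtain ⟨δ, hδ, H⟩ := exists_uniform_nhds_zero (huc hU)
  refine ⟨δ, hδ, fun T v hv => ?_⟩
  by_contra! hle
  have hpre : IsPreconnected (ball (0 : E d) δ) := (convex_ball _ _).isPreconnected
  obtain ⟨w, hw, hwa⟩ := hpre.intermediate_value (mem_ball_self hδ) (by simpa using hv)
    (f := fun v => ‖α T v‖) (hα.continuous_apply hc T).norm.continuousOn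
    ⟨by simp [hα.map_zero, ha.le], hle⟩
  simp only at hwa
  refine hno (h T) (α T w) hwa.ge hwa.le ?_
  rw [← hα]
  exact H T w (by simpa using hw)

theorem exists_add_eq_of_norm_le {δ : ℝ} {n : ℕ} {v : E d} (hv : ‖v‖ ≤ (n + 1 : ℕ) * δ) :
    ∃ v₁ v₂, v₁ + v₂ = v ∧ ‖v₁‖ ≤ n * δ ∧ ‖v₂‖ ≤ δ := by
  have hn : (0 : ℝ) < (n : ℝ) + 1 := by positivity
  push_cast at hv
  have hle : ‖v‖ / ((n : ℝ) + 1) ≤ δ := by rwa [div_le_iff₀' hn]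
  refine ⟨((n : ℝ) / (n + 1)) • v, (1 / ((n : ℝ) + 1)) • v, ?_, ?_, ?_⟩
  · rw [← add_smul, ← add_div, div_self hn.ne', one_smul]
  · rw [norm_smul, Real.norm_of_nonneg (by positivity), div_mul_eq_mul_div, mul_div_assoc]
    gcongr
  · rw [norm_smul, Real.norm_of_nonneg (by positivity), div_mul_eq_mul_div, one_mul]
    exact hle

theorem IsCocycleOf.exists_norm_le [CompactSpace X] [CompactSpace X'] {h : Ω → Ω'}
    (hc : Continuous h) {α : Ω → E d → E d} (hα : IsCocycleOf h α) (L : ℝ) :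
    ∃ C, ∀ T v, ‖v‖ ≤ L → ‖α T v‖ ≤ C := by
  obtain ⟨δ, hδ, H⟩ := hα.exists_norm_lt hc one_pos
  have hδ2 := half_pos hδ
  have key : ∀ (n : ℕ) T v, ‖v‖ ≤ n * (δ / 2) → ‖α T v‖ ≤ n := by
    intro n
    induction n with
    | zero =>
      intro T v hv
      obtain rfl : v = 0 := by simpa using hv
      simp [hα.map_zero]
    | succ n ih =>
      intro T v hv
      obtain ⟨v₁, v₂, rfl, h1, h2⟩ := exists_add_eq_of_norm_le hv
      rw [← hα.map_add]
      push_cast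
      exact (norm_add_le _ _).trans (add_le_add (ih T v₁ h1) (H _ v₂ (by linarith)).le)
  obtain ⟨n, hn⟩ := exists_nat_ge (L / (δ / 2))
  rw [div_le_iff₀ hδ2] at hn
  exact ⟨n, fun T v hv => key n T v (hv.trans hn)⟩

/-- The values are locally bounded, so they converge along ultrafilters; applying the action to the
limit identifies it with `α T x`. -/
theorem IsCocycleOf.continuous [CompactSpace X] [CompactSpace X'] {h : Ω → Ω'}
    (hc : Continuous h) {α : Ω → E d → E d} (hα : IsCocycleOf h α) :
    Continuous fun p : Ω × E d => α p.1 p.2 := by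
  rw [continuous_iff_continuousAt]
  rintro ⟨T, x⟩
  obtain ⟨C, hC⟩ := hα.exists_norm_le hc (‖x‖ + 1)
  rw [ContinuousAt, tendsto_iff_ultrafilter]
  intro 𝓖 hG
  have hmem : closedBall (0 : E d) C ∈ 𝓖.map fun p : Ω × E d => α p.1 p.2 := by
    have : ∀ᶠ p : Ω × E d in 𝓝 (T, x), ‖p.2‖ < ‖x‖ + 1 :=
      (continuous_snd.norm.tendsto (T, x)).eventually (gt_mem_nhds (by simp))
    rw [Ultrafilter.mem_map]
    filter_upwards [hG this] with p hp
    simpa using hC p.1 p.2 (le_of_lt hp)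
  obtain ⟨c, -, hlim⟩ := isCompact_iff_ultrafilter_le_nhds'.1
    (isCompact_closedBall (0 : E d) C) _ hmem
  have h1 : Tendsto (fun p : Ω × E d => tmove (h p.1) (α p.1 p.2)) 𝓖 (𝓝 (tmove (h T) c)) :=
    (continuous_tmove.tendsto (h T, c)).comp
      (((hc.comp continuous_fst).tendsto (T, x) |>.mono_left hG).prodMk_nhds hlim)
  have h2 : Tendsto (fun p : Ω × E d => tmove (h p.1) (α p.1 p.2)) 𝓖 (𝓝 (tmove (h T) (α T x))) := by
    simp_rw [← hα _ _]
    exact ((hc.comp continuous_tmove).tendsto (T, x)).mono_left hG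
  rw [← tmove_injective _ (tendsto_nhds_unique h1 h2)]
  exact hlim

theorem IsOrbitEquivalence.symm {h : Ω ≃ₜ Ω'} (hh : IsOrbitEquivalence h) :
    IsOrbitEquivalence h.symm := by
  intro S
  have := hh (h.symm S)
  rw [h.apply_symm_apply] at this
  rw [← this, ← image_comp]
  simp

theorem IsOrbitEquivalence.exists_isCocycleOf {h : Ω ≃ₜ Ω'} (hh : IsOrbitEquivalence h) :
    ∃ α : Ω → E d → E d, IsCocycleOf h α := by
  have : ∀ T v, ∃ w, tmove (h T) w = h (tmove T v) := by
    intro T v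
    have : h (tmove T v) ∈ h '' orb T := mem_image_of_mem _ ⟨v, rfl⟩
    rw [hh T] at this
    exact this
  choose α hα using this
  exact ⟨α, fun T v => (hα T v).symm⟩

theorem IsCocycleOf.mem_weakCocycles [CompactSpace X] [CompactSpace X'] {h : Ω → Ω'}
    (hc : Continuous h) {α : Ω → E d → E d} (hα : IsCocycleOf h α) : α ∈ weakCocycles Ω :=
  ⟨hα.continuous hc, hα.map_add⟩

theorem IsCocycleOf.perturb {h : Ω → Ω'} {α : Ω → E d → E d} (hα : IsCocycleOf h α)
    (s : Ω → E d) : IsCocycleOf (fun T => tmove (h T) (s T)) (α + coboundary s) := by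
  intro T v
  simp only [Pi.add_apply, coboundary]
  rw [hα, tmove_tmove, tmove_tmove]
  congr 1
  abel

end

end TilingClassification

namespace TilingClassification

/-! ### Orbit equivalences with cohomologous cocycles -/

variable {d : ℕ} {X X₁ X₂ : Type*} [MetricSpace X] [MetricSpace X₁] [MetricSpace X₂]
  {Ω : TilingSpace d X} {Ω₁ : TilingSpace d X₁} {Ω₂ : TilingSpace d X₂}

theorem IsOrbitEquivalence.exists_apply_eq {h : Ω ≃ₜ Ω₁} (hh : IsOrbitEquivalence h)
    {T : Ω} {w : E d} : ∃ v, h (tmove T v) = tmove (h T) w := by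
  have : tmove (h T) w ∈ h '' orb T := by
    rw [hh T]
    exact ⟨w, rfl⟩
  obtain ⟨_, ⟨v, rfl⟩, hv⟩ := this
  exact ⟨v, hv⟩

/-- If the cocycles of two orbit equivalences differ by the coboundary of `σ`, then the maps
`h₁` and `T ↦ h₂(T) - σ(T)` differ by a topological conjugacy. -/
theorem exists_conjugacy_of_cohomologous [CompactSpace X] [CompactSpace X₂]
    {h₁ : Ω ≃ₜ Ω₁} {h₂ : Ω ≃ₜ Ω₂} (hh₁ : IsOrbitEquivalence h₁) (hh₂ : IsOrbitEquivalence h₂)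
    {α₁ α₂ : Ω → E d → E d} (hα₁ : IsCocycleOf h₁ α₁) (hα₂ : IsCocycleOf h₂ α₂) {σ : Ω → E d}
    (hσ : Continuous σ) (hα : α₁ = α₂ + coboundary σ) :
    ∃ s : Ω → E d, Continuous s ∧ IsHomeomorph (fun T : Ω => tmove T (s T)) ∧
      ∃ φ : Ω₁ ≃ₜ Ω₂, IsConjugacy φ ∧ (∀ T : Ω, h₂ (tmove T (s T)) = φ (h₁ T)) ∧
        ∀ T : Ω, φ (h₁ T) = tmove (h₂ T) (σ T) := by
  let f : Ω → Ω₂ := fun T => tmove (h₂ T) (σ T)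
  have hf : Continuous f := Continuous.tmove h₂.continuous hσ
  have hfα : IsCocycleOf f α₁ := hα ▸ hα₂.perturb σ
  have hinj : Function.Injective f := by
    intro T T' h
    obtain ⟨v, hv⟩ := hh₂.exists_apply_eq (T := T) (w := σ T - σ T')
    have h1 : h₂ T' = h₂ (tmove T v) := by
      have h3 : tmove (f T) (-σ T') = h₂ T' := by
        rw [h, tmove_tmove, add_neg_cancel, tmove_zero]
      rw [hv, ← h3, tmove_tmove, sub_eq_add_neg]
    obtain rfl := h₂.injective h1
    rw [hfα] at h
    have h0 : α₁ T v = 0 := tmove_injective (f T) (h.symm.trans (tmove_zero _).symm)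
    apply h₁.injective
    rw [hα₁, h0, tmove_zero]
  have hsurj : Function.Surjective f := by
    intro S
    suffices range f = univ from range_eq_univ.1 this S
    refine eq_univ_of_isClosed_of_tmove_mem (T := f (h₂.symm S)) (isCompact_range hf).isClosed
      fun w => ?_
    obtain ⟨v, hv⟩ := hh₁.exists_apply_eq (T := h₂.symm S) (w := w)
    rw [hα₁] at hv
    refine ⟨tmove (h₂.symm S) v, ?_⟩
    rw [hfα, tmove_injective _ hv]
  let F : Ω ≃ₜ Ω₂ :=
    Continuous.homeoOfEquivCompactToT2 (f := Equiv.ofBijective f ⟨hinj, hsurj⟩) hf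
  have hF : ∀ T, F T = f T := fun _ => rfl
  -- Displacing `h₂ T` by `σ T` amounts to displacing `T` by `β (h₂ T) (σ T)`, which is the required
  -- `s`.
  obtain ⟨β, hβ⟩ := hh₂.symm.exists_isCocycleOf
  have hs : ∀ T, tmove T (β (h₂ T) (σ T)) = h₂.symm (F T) := by
    intro T
    rw [hF, hβ, h₂.symm_apply_apply]
  refine ⟨fun T => β (h₂ T) (σ T), (hβ.continuous h₂.symm.continuous).comp
    (h₂.continuous.prodMk hσ), ?_, h₁.symm.trans F, ?_, ?_, ?_⟩
  · simp_rw [hs]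
    exact (F.trans h₂.symm).isHomeomorph
  · intro S w
    obtain ⟨v, hv⟩ := hh₁.exists_apply_eq (T := h₁.symm S) (w := w)
    rw [h₁.apply_symm_apply] at hv
    simp only [Homeomorph.trans_apply]
    rw [← hv, h₁.symm_apply_apply, hF, hF, hfα]
    congr 1
    apply tmove_injective S
    rw [← hv, hα₁, h₁.apply_symm_apply]
  · intro T
    rw [hs]
    simp
  · intro T
    simp only [Homeomorph.trans_apply, h₁.symm_apply_apply]
    rfl

theorem weakClass_eq_mk {h : Ω → Ω₁} {α : weakCocycles Ω} (hα : IsCocycleOf h α) :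
    weakClass h = Submodule.Quotient.mk α := by
  have H : ∃ α : weakCocycles Ω, IsCocycleOf h α := ⟨α, hα⟩
  rw [weakClass, dif_pos H, Subtype.ext (H.choose_spec.unique hα)]

/-- The perturbation is not unique, so only some representative is exhibited; this suffices for
comparing classes. -/
theorem exists_strongClass_eq_mk {h : Ω → Ω₁}
    (H : ∃ α : strongCocycles Ω, IsStrongRepresentative h α) :
    ∃ α : strongCocycles Ω, IsStrongRepresentative h α ∧
      strongClass h = Submodule.Quotient.mk α := by
  refine ⟨H.choose, H.choose_spec, ?_⟩
  rw [strongClass, dif_pos H]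

end TilingClassification

namespace TilingClassification

variable {d : ℕ} {X X' X₁ X₂ : Type*} [MetricSpace X] [MetricSpace X'] [MetricSpace X₁]
  [MetricSpace X₂] {Ω : TilingSpace d X} {Ω' : TilingSpace d X'} {Ω₁ : TilingSpace d X₁}
  {Ω₂ : TilingSpace d X₂}

/-! ### Pattern-equivariant bump functions -/

/-- A bump function at `T₀` that only depends on patches: its value at `T` is `η - ‖y‖` if a
translate `T - y` with `‖y‖ < η` has the same patch of radius `R` as `T₀`. -/
def bump (R η : ℝ) (T₀ T : Ω) : ℝ :=
  sSup (insert 0 {c | ∃ y : E d, SamePatch R T₀ (tmove T y) ∧ c = η - ‖y‖})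

theorem bddAbove_bump {R η : ℝ} (hη : 0 < η) (T₀ T : Ω) :
    BddAbove (insert 0 {c | ∃ y : E d, SamePatch R T₀ (tmove T y) ∧ c = η - ‖y‖}) := by
  refine ⟨η, ?_⟩
  rintro c (rfl | ⟨y, -, rfl⟩)
  · exact hη.le
  · linarith [norm_nonneg y]

theorem bump_nonneg {R η : ℝ} (hη : 0 < η) (T₀ T : Ω) : 0 ≤ bump R η T₀ T :=
  le_csSup (bddAbove_bump hη T₀ T) (mem_insert _ _)

theorem le_bump {R η : ℝ} (hη : 0 < η) {T₀ T : Ω} {y : E d} (h : SamePatch R T₀ (tmove T y)) :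
    η - ‖y‖ ≤ bump R η T₀ T :=
  le_csSup (bddAbove_bump hη T₀ T) (Or.inr ⟨y, h, rfl⟩)

theorem exists_samePatch_of_bump_pos {R η : ℝ} {T₀ T : Ω} (h : 0 < bump R η T₀ T) :
    ∃ y : E d, ‖y‖ < η ∧ SamePatch R T₀ (tmove T y) := by
  obtain ⟨c, hc, h0⟩ := exists_lt_of_lt_csSup (insert_nonempty _ _) h
  rcases hc with rfl | ⟨y, hy, rfl⟩
  · exact absurd h0 (lt_irrefl _)
  · exact ⟨y, by linarith, hy⟩

/-- A translation by `z` changes the competing displacements `y` by at most `‖z‖`. Only `‖y‖ < η`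
matters, which explains the margin `R + η`. -/
theorem bump_le_add {R η : ℝ} (hη : 0 < η) (T₀ : Ω) {T T' : Ω} {z : E d}
    (h : SamePatch (R + η) T (tmove T' z)) : bump R η T₀ T ≤ bump R η T₀ T' + ‖z‖ := by
  have h0 := bump_nonneg (R := R) hη T₀ T'
  refine csSup_le (insert_nonempty _ _) ?_
  rintro c (rfl | ⟨y, hy, rfl⟩)
  · positivity
  · rcases le_or_gt η ‖y‖ with hle | hlt
    · linarith [norm_nonneg z]
    · have h1 : SamePatch R T₀ (tmove T' (z + y)) := by
        refine hy.trans ?_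
        rw [← tmove_tmove]
        exact h.tmove (by linarith)
      linarith [le_bump hη h1, norm_add_le z y]

theorem bump_eq_of_samePatch {R η : ℝ} (hη : 0 < η) (T₀ : Ω) {T T' : Ω}
    (h : SamePatch (R + η) T T') : bump R η T₀ T = bump R η T₀ T' := by
  refine le_antisymm ?_ ?_
  · simpa using bump_le_add (z := 0) hη T₀ (by rwa [tmove_zero])
  · simpa using bump_le_add (z := 0) hη T₀ (by rw [tmove_zero]; exact h.symm)

theorem continuous_bump [CompactSpace X] (hΩ : Ω.FLC) {R η : ℝ} (hη : 0 < η) (T₀ : Ω) :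
    Continuous (bump R η T₀) := by
  rw [continuous_iff_continuousAt]
  intro T
  rw [ContinuousAt, Metric.tendsto_nhds]
  intro ε hε
  obtain ⟨U, hU, H⟩ := hΩ.exists_samePatch_tmove (R + η) hε
  filter_upwards [mem_nhds_left T hU, mem_nhds_right T hU] with T' h1 h2
  obtain ⟨z, hz, hs⟩ := H _ _ h1
  obtain ⟨z', hz', hs'⟩ := H _ _ h2
  rw [Real.dist_eq, abs_lt]
  constructor <;> linarith [bump_le_add hη T₀ hs', bump_le_add hη T₀ hs]

/-! ### Local perturbations of continuous maps -/

/-- A continuous map between FLC tiling spaces has an arbitrarily small perturbation along orbits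
whose patches of a given radius are locally determined. -/
theorem exists_local_perturbation [CompactSpace X] [CompactSpace X'] (hΩ : Ω.FLC) (hΩ' : Ω'.FLC)
    {h : Ω → Ω'} (hc : Continuous h) (r : ℝ) {ε : ℝ} (hε : 0 < ε) :
    ∃ s : Ω → E d, Continuous s ∧ (∀ T, ‖s T‖ ≤ ε) ∧ ∃ R > 0, ∀ T T' : Ω, SamePatch R T T' →
      SamePatch r (tmove (h T) (s T)) (tmove (h T') (s T')) := by
  obtain ⟨r₀, hr₀, R₀, hR₀, rigid⟩ := Ω'.exists_rigid
  obtain ⟨δ, hδ, hδε, hδr, hδ1⟩ : ∃ δ > 0, δ ≤ ε ∧ δ ≤ r₀ / 3 ∧ δ ≤ 1 :=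
    ⟨min ε (min (r₀ / 3) 1), by positivity, by simp⟩
  obtain ⟨r₂, hr₂, hr₂'⟩ : ∃ r₂, r + 1 ≤ r₂ ∧ R₀ + 1 ≤ r₂ :=
    ⟨max (r + 1) (R₀ + 1), le_max_left _ _, le_max_right _ _⟩
  obtain ⟨U, hU, HU⟩ := hΩ'.exists_samePatch_tmove r₂ hδ
  have huc := CompactSpace.uniformContinuous_of_continuous hc
  obtain ⟨V, hV, hVs, hVU⟩ := comp_symm_mem_uniformity_sets (mem_map.1 (huc hU))
  obtain ⟨R, hR, HR⟩ := Ω.exists_samePatch_imp_mem hV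
  obtain ⟨η, hη, Hη⟩ := exists_uniform_nhds_zero hV
  obtain ⟨F, -, hF⟩ := (isCompact_univ (X := Ω)).elim_nhds_subcover
    (fun T₀ => {T | 0 < bump R η T₀ T}) fun T₀ _ => by
      refine (isOpen_lt continuous_const (continuous_bump hΩ hη T₀)).mem_nhds ?_
      have : SamePatch R T₀ (tmove T₀ 0) := by rw [tmove_zero]; rfl
      have := le_bump hη this
      rw [norm_zero] at this
      exact lt_of_lt_of_le (by linarith) this
  -- The vector `x i T` aligns the patch of `h T` with that of `h i`; the default `0` is used where
  -- the weight vanishes.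
  have hex : ∀ i T : Ω, ∃ x : E d, ‖x‖ ≤ δ ∧
      (0 < bump R η i T → SamePatch r₂ (h i) (tmove (h T) x)) := by
    intro i T
    by_cases hb : 0 < bump R η i T
    · obtain ⟨y, hy, hs⟩ := exists_samePatch_of_bump_pos hb
      obtain ⟨x, hx, hx'⟩ := HU (h i) (h T) (@hVU (i, T) ⟨_, HR _ _ hs, hVs.symm _ _ (Hη T y hy)⟩)
      exact ⟨x, hx.le, fun _ => hx'⟩
    · exact ⟨0, by simpa using hδ.le, fun h => absurd h hb⟩
  choose x hxδ hx using hex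
  -- Rigidity forces all aligning vectors to change by the same `z`; the three terms bounded by `δ ≤
  -- r₀ / 3` sum to less than `r₀`.
  have hadd : ∀ {i T T' : Ω} {z : E d}, ‖z‖ < δ → SamePatch r₂ (h T) (tmove (h T') z) →
      0 < bump R η i T → 0 < bump R η i T' → x i T' = z + x i T := by
    intro i T T' z hz hs hT hT'
    refine rigid (h T') _ _ ?_ ?_
    · calc ‖x i T' - (z + x i T)‖ ≤ ‖x i T'‖ + ‖z + x i T‖ := norm_sub_le _ _
        _ ≤ ‖x i T'‖ + (‖z‖ + ‖x i T‖) := by gcongr; exact norm_add_le _ _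
        _ < r₀ := by linarith [hxδ i T, hxδ i T']
    · have h1 : SamePatch R₀ (tmove (h T) (x i T)) (tmove (h T') (z + x i T)) := by
        rw [← tmove_tmove]
        exact hs.tmove (by linarith [hxδ i T])
      exact (((hx i T' hT').symm.trans (hx i T hT)).mono (by linarith)).trans h1
  have hcont : ∀ i, Continuous fun T => bump R η i T • x i T := by
    intro i
    rw [continuous_iff_continuousAt]
    intro T
    have hb := (continuous_bump hΩ (R := R) hη i).tendsto T
    rcases (bump_nonneg (R := R) hη i T).eq_or_lt with h0 | h0
    · rw [ContinuousAt, ← h0, zero_smul]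
      rw [← h0] at hb
      refine squeeze_zero_norm (fun T' => ?_) (by simpa using hb.mul_const δ)
      rw [norm_smul, Real.norm_of_nonneg (bump_nonneg hη i T')]
      exact mul_le_mul_of_nonneg_left (hxδ i T') (bump_nonneg hη i T')
    · refine hb.smul (Metric.tendsto_nhds.2 fun e he => ?_)
      obtain ⟨U', hU', HU'⟩ := hΩ'.exists_samePatch_tmove r₂ (lt_min he hδ)
      filter_upwards [hb.eventually (lt_mem_nhds h0), mem_nhds_left T (huc hU')] with T' h1 h2
      obtain ⟨z, hz, hs⟩ := HU' _ _ h2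
      rw [hadd (hz.trans_le (min_le_right _ _)) hs h0 h1, dist_eq_norm, add_sub_cancel_right]
      exact hz.trans_le (min_le_left _ _)
  have hpos : ∀ T, 0 < ∑ i ∈ F, bump R η i T := by
    intro T
    obtain ⟨i, hi, hiT⟩ := mem_iUnion₂.1 (hF (mem_univ T))
    exact Finset.sum_pos' (fun j _ => bump_nonneg hη j T) ⟨i, hi, hiT⟩
  have hs : ∀ T, ‖(∑ i ∈ F, bump R η i T)⁻¹ • ∑ i ∈ F, bump R η i T • x i T‖ ≤ δ := by
    intro T
    rw [norm_smul, norm_inv, Real.norm_of_nonneg (hpos T).le, inv_mul_le_iff₀ (hpos T),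
      Finset.sum_mul]
    refine norm_sum_le_of_le _ fun i _ => ?_
    rw [norm_smul, Real.norm_of_nonneg (bump_nonneg hη i T)]
    exact mul_le_mul_of_nonneg_left (hxδ i T) (bump_nonneg hη i T)
  -- With equal patches the weights agree and every aligning vector shifts by `z`, so their weighted
  -- average shifts by `z` too.
  refine ⟨fun T => (∑ i ∈ F, bump R η i T)⁻¹ • ∑ i ∈ F, bump R η i T • x i T, ?_,
    fun T => (hs T).trans hδε, R + η, by positivity, fun T T' hTT' => ?_⟩
  · exact ((continuous_finsetSum _ fun i _ => continuous_bump hΩ hη i).inv₀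
      fun T => (hpos T).ne').smul (continuous_finsetSum _ fun i _ => hcont i)
  · have hV' : (T, T') ∈ V := HR _ _ (hTT'.mono (by linarith))
    obtain ⟨z, hz, hzs⟩ := HU (h T) (h T') (@hVU (T, T') ⟨T', hV', refl_mem_uniformity hV⟩)
    have hsum : (∑ i ∈ F, bump R η i T')⁻¹ • ∑ i ∈ F, bump R η i T' • x i T' =
        z + (∑ i ∈ F, bump R η i T)⁻¹ • ∑ i ∈ F, bump R η i T • x i T := by
      have h1 : ∀ i, bump R η i T' = bump R η i T := fun i => (bump_eq_of_samePatch hη i hTT').symm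
      have h2 : ∑ i ∈ F, bump R η i T' • x i T' =
          (∑ i ∈ F, bump R η i T) • z + ∑ i ∈ F, bump R η i T • x i T := by
        rw [Finset.sum_smul, ← Finset.sum_add_distrib]
        refine Finset.sum_congr rfl fun i _ => ?_
        rw [h1]
        rcases (bump_nonneg (R := R) hη i T).eq_or_lt with h0 | h0
        · simp [← h0]
        · rw [hadd hz hzs h0 (by rwa [h1]), smul_add]
      rw [h2, smul_add, Finset.sum_congr rfl fun i _ => h1 i, smul_smul,
        inv_mul_cancel₀ (hpos T).ne', one_smul]
    simp only
    rw [hsum, ← tmove_tmove]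
    exact hzs.tmove (by linarith [hs T])

/-- Orbit equivalences between FLC tiling spaces have strong representatives. -/
theorem IsOrbitEquivalence.exists_isStrongRepresentative [CompactSpace X] [CompactSpace X']
    (hΩ : Ω.FLC) (hΩ' : Ω'.FLC) {h : Ω ≃ₜ Ω'} (hh : IsOrbitEquivalence h) :
    ∃ α : strongCocycles Ω, IsStrongRepresentative h α := by
  obtain ⟨r₀, hr₀, R₀, hR₀, rigid⟩ := Ω'.exists_rigid
  -- For small `v` the perturbed cocycle is below `3ε`: two such values differ by less than `r₀`,
  -- and each moves a patch by less than `1`.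
  obtain ⟨ε, hε, hεr, hε1⟩ : ∃ ε > 0, ε ≤ r₀ / 6 ∧ ε ≤ 1 / 3 :=
    ⟨min (r₀ / 6) (1 / 3), by positivity, by simp⟩
  obtain ⟨s, hsc, hsε, R, hR, hloc⟩ :=
    exists_local_perturbation hΩ hΩ' h.continuous (R₀ + 1) hε
  obtain ⟨α, hα⟩ := hh.exists_isCocycleOf
  obtain ⟨β, hβ⟩ := hh.symm.exists_isCocycleOf
  obtain ⟨δ, hδ, hαδ⟩ := hα.exists_norm_lt h.continuous hε
  set f : Ω → Ω' := fun T => tmove (h T) (s T) with hf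
  set γ : Ω → E d → E d := α + coboundary s with hγ
  have hfγ : IsCocycleOf f γ := hα.perturb s
  have hfc : Continuous f := Continuous.tmove h.continuous hsc
  have small : ∀ T v, ‖v‖ < δ → ‖γ T v‖ < 3 * ε := by
    intro T v hv
    have h1 : ‖s (tmove T v) - s T‖ ≤ ε + ε :=
      (norm_sub_le _ _).trans (add_le_add (hsε _) (hsε _))
    calc ‖γ T v‖ ≤ ‖α T v‖ + ‖s (tmove T v) - s T‖ := norm_add_le _ _
      _ < 3 * ε := by linarith [hαδ T v hv]
  have step : ∀ (T T' : Ω) v, ‖v‖ < δ → SamePatch (R + ‖v‖) T T' → γ T v = γ T' v := by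
    intro T T' v hv hs
    refine rigid (f T') _ _ ?_ ?_
    · linarith [norm_sub_le (γ T v) (γ T' v), small T v hv, small T' v hv]
    · have h1 : SamePatch (R₀ + 1) (f (tmove T v)) (f (tmove T' v)) :=
        hloc _ _ (hs.tmove (by linarith))
      have h2 : SamePatch (R₀ + 1) (f T) (f T') := hloc _ _ (hs.mono (by linarith [norm_nonneg v]))
      rw [hfγ, hfγ] at h1
      exact (h2.tmove (by linarith [small T v hv])).symm.trans (h1.mono (by linarith))
  have chain : ∀ (n : ℕ) (T T' : Ω) v, ‖v‖ ≤ n * (δ / 2) → SamePatch (R + n * (δ / 2)) T T' →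
      γ T v = γ T' v := by
    intro n
    induction n with
    | zero =>
      intro T T' v hv _
      obtain rfl : v = 0 := by simpa using hv
      rw [hfγ.map_zero, hfγ.map_zero]
    | succ n ih =>
      intro T T' v hv hs
      obtain ⟨v₁, v₂, rfl, h1, h2⟩ := exists_add_eq_of_norm_le hv
      push_cast at hs
      rw [← hfγ.map_add, ← hfγ.map_add, ih T T' v₁ h1 (hs.mono (by linarith)),
        step (tmove T v₁) (tmove T' v₁) v₂ (by linarith) (hs.tmove (by linarith))]
  have unif : ∀ L : ℝ, ∃ R' > 0, ∀ (T T' : Ω) v, ‖v‖ ≤ L → SamePatch R' T T' → γ T v = γ T' v := by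
    intro L
    obtain ⟨n, hn⟩ := exists_nat_ge (L / (δ / 2))
    rw [div_le_iff₀ (half_pos hδ)] at hn
    exact ⟨R + n * (δ / 2), by positivity, fun T T' v hv hs => chain n T T' v (hv.trans hn) hs⟩
  have hw := hfγ.mem_weakCocycles hfc
  refine ⟨⟨γ, hw, fun v => ⟨hw.1.comp (continuous_id.prodMk continuous_const), ?_⟩⟩, s, hsc,
    ⟨hfc, fun r hr => ?_⟩, hfγ⟩
  · obtain ⟨R', hR', H⟩ := unif ‖v‖
    exact ⟨R', hR', fun T T' hs => H T T' v le_rfl hs⟩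
  · obtain ⟨C, hC⟩ := hβ.exists_norm_le h.symm.continuous r
    obtain ⟨R', hR', H⟩ := unif C
    refine ⟨max R' (R + C), lt_max_of_lt_left hR', fun T T' hs => ?_⟩
    -- Locality is known only at radius `R₀ + 1`. To reach radius `r`, each `p` in the ball is
    -- written as `α T v`; the nearby point `γ T v` and the patch there are locally determined.
    refine SamePatch.of_forall_ball (r₁ := R₀ + 1) fun p hp => ?_
    rw [mem_ball_zero_iff] at hp
    set v := β (h T) p with hv
    have hvC : ‖v‖ ≤ C := hC _ p hp.le
    have hp' : p = α T v := by
      apply tmove_injective (h T)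
      have := hβ (h T) p
      rw [h.symm_apply_apply, h.symm_apply_eq] at this
      rw [this, hα]
    refine ⟨γ T v, ?_, ?_⟩
    · have h1 : p - γ T v = s T - s (tmove T v) := by
        rw [hp', hγ]
        simp only [Pi.add_apply, coboundary]
        abel
      rw [h1]
      linarith [norm_sub_le (s T) (s (tmove T v)), hsε T, hsε (tmove T v)]
    · rw [← hfγ, H T T' v hvC (hs.mono (le_max_left _ _)), ← hfγ]
      exact hloc _ _ (hs.tmove (by linarith [le_max_right R' (R + C)]))

/-! ### Locality of conjugacies -/

/-- A conjugacy that intertwines a local perturbation of a homeomorphism with a local map is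
local. -/
theorem isLocalMap_of_intertwines [CompactSpace X] [CompactSpace X₁] (hΩ : Ω.FLC)
    {h : Ω ≃ₜ Ω₁} (hh : IsOrbitEquivalence h) {s : Ω → E d} (hs : Continuous s)
    (hf₁ : IsLocalMap fun T => tmove (h T) (s T)) {f₂ : Ω → Ω₂} (hf₂ : IsLocalMap f₂)
    {φ : Ω₁ ≃ₜ Ω₂} (hφ : IsConjugacy φ) (hφf : ∀ T, φ (tmove (h T) (s T)) = f₂ T) :
    IsLocalMap φ := by
  refine ⟨φ.continuous, fun r hr => ?_⟩
  obtain ⟨α, hα⟩ := hh.exists_isCocycleOf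
  obtain ⟨L, hL⟩ : ∃ L, ∀ T, ‖s T‖ ≤ L := by
    obtain ⟨L, hL⟩ := (isCompact_range hs).isBounded.exists_norm_le
    exact ⟨L, fun T => hL _ ⟨T, rfl⟩⟩
  obtain ⟨r₀, hr₀, R₀, hR₀, rigid⟩ := Ω₁.exists_rigid
  obtain ⟨A, hA, HA⟩ := hf₁.2 R₀ hR₀
  obtain ⟨B, hB, HB⟩ := hf₂.2 (max (r + L) 1) (by positivity)
  obtain ⟨C, hC, HC⟩ := Ω.exists_samePatch_imp_mem
    (CompactSpace.uniformContinuous_of_continuous hs (dist_mem_uniformity (half_pos hr₀)))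
  obtain ⟨δ, hδ, hαδ⟩ := hα.exists_norm_lt h.continuous (half_pos hr₀)
  obtain ⟨U, hU, HU⟩ := hΩ.exists_samePatch_tmove (max A (max B C)) hδ
  obtain ⟨D, hD, HD⟩ := Ω₁.exists_samePatch_imp_mem
    (CompactSpace.uniformContinuous_of_continuous h.symm.continuous hU)
  refine ⟨max D R₀ + 2 * |L|, by positivity, fun S S' hSS' => ?_⟩
  obtain ⟨T, rfl⟩ := h.surjective S
  have hL' : ∀ T, ‖s T‖ ≤ |L| := fun T => (hL T).trans (le_abs_self L)
  -- The preimages of `S` and `S'` are close, so by FLC a small translate `T'` of the second has the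
  -- same large patch as `T`.
  obtain ⟨z, hz, hTz⟩ := HU T (h.symm S') (by
    have := HD _ _ (hSS'.mono (by linarith [le_max_left D R₀, abs_nonneg L]))
    rwa [mem_preimage, h.symm_apply_apply] at this)
  set T' := tmove (h.symm S') z with hT'
  have hT'S : tmove (h T') (s T') = tmove S' (α (h.symm S') z + s T') := by
    rw [hT', hα, h.apply_symm_apply, tmove_tmove]
  -- Both sides are translates of `S'` with equal patches, by vectors that differ by less than `r₀/2
  -- + r₀/2`; rigidity identifies them.
  have hEq : tmove (h T') (s T') = tmove S' (s T) := by
    rw [hT'S]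
    congr 1
    refine rigid S' _ _ ?_ ?_
    · have h1 : dist (s T) (s T') < r₀ / 2 := HC T T' (hTz.mono (by simp))
      rw [dist_comm, dist_eq_norm] at h1
      rw [add_sub_assoc]
      exact (norm_add_le _ _).trans_lt (by linarith [hαδ (h.symm S') z hz])
    · rw [← hT'S]
      have h1 := HA T T' (hTz.mono (by simp))
      refine h1.symm.trans (hSS'.tmove ?_)
      linarith [le_max_right D R₀, abs_nonneg L, hL' T]
  have h2 := HB T T' (hTz.mono (by simp))
  rw [← hφf, ← hφf, hEq, hφ, hφ] at h2
  have h3 := h2.tmove (R' := r) (v := -s T) (by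
    rw [norm_neg]; linarith [hL T, le_max_left (r + L) 1])
  simpa only [tmove_tmove, add_neg_cancel, tmove_zero] using h3

theorem IsLocalMap.tmove_of_isStronglyPE [CompactSpace X] {f : Ω → Ω'} (hf : IsLocalMap f)
    {σ : Ω → E d} (hσ : IsStronglyPE σ) : IsLocalMap fun T => tmove (f T) (σ T) := by
  refine ⟨Continuous.tmove hf.1 hσ.1, fun r hr => ?_⟩
  obtain ⟨L, hL⟩ := (isCompact_range hσ.1).isBounded.exists_norm_le
  obtain ⟨A, hA, HA⟩ := hf.2 (r + |L|) (by positivity)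
  obtain ⟨-, B, hB, HB⟩ := hσ
  refine ⟨max A B, lt_max_of_lt_left hA, fun T T' h => ?_⟩
  simp only
  rw [← HB T T' (h.mono (le_max_right _ _))]
  refine (HA T T' (h.mono (le_max_left _ _))).tmove ?_
  linarith [hL _ ⟨T, rfl⟩, le_abs_self L]

end TilingClassification

end

/-! ### The classification theorem -/

open TilingClassification in
theorem mainTheorem1 {d : ℕ} {X X₁ X₂ : Type*}
    [MetricSpace X] [CompactSpace X] [MetricSpace X₁] [CompactSpace X₁]
    [MetricSpace X₂] [CompactSpace X₂]
    (Ω : TilingSpace d X) (Ω₁ : TilingSpace d X₁) (Ω₂ : TilingSpace d X₂)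
    (h₁ : Ω ≃ₜ Ω₁) (h₂ : Ω ≃ₜ Ω₂)
    (hh₁ : IsOrbitEquivalence h₁) (hh₂ : IsOrbitEquivalence h₂) :
    (weakClass h₁ = weakClass h₂ →
      ∃ s : Ω → E d, Continuous s ∧ IsHomeomorph (fun T : Ω => tmove T (s T)) ∧
        ∃ φ : Ω₁ ≃ₜ Ω₂, IsConjugacy φ ∧ ∀ T : Ω, h₂ (tmove T (s T)) = φ (h₁ T)) ∧
    (Ω.FLC → Ω₁.FLC → Ω₂.FLC → strongClass h₁ = strongClass h₂ →
      ∃ s : Ω → E d, Continuous s ∧ IsHomeomorph (fun T : Ω => tmove T (s T)) ∧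
        ∃ φ : Ω₁ ≃ₜ Ω₂, IsMLD φ ∧ ∀ T : Ω, h₂ (tmove T (s T)) = φ (h₁ T)) := by
  obtain ⟨α₁, hα₁⟩ := hh₁.exists_isCocycleOf
  obtain ⟨α₂, hα₂⟩ := hh₂.exists_isCocycleOf
  constructor
  · intro H
    rw [weakClass_eq_mk (α := ⟨α₁, hα₁.mem_weakCocycles h₁.continuous⟩) hα₁,
      weakClass_eq_mk (α := ⟨α₂, hα₂.mem_weakCocycles h₂.continuous⟩) hα₂,
      Submodule.Quotient.eq] at H
    obtain ⟨σ, hσ, hEq⟩ := H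
    obtain ⟨s, hs, hs', φ, hφ, hφ', -⟩ := exists_conjugacy_of_cohomologous hh₁ hh₂ hα₁ hα₂ hσ
      (sub_eq_iff_eq_add'.1 hEq)
    exact ⟨s, hs, hs', φ, hφ, hφ'⟩
  · intro hΩ hΩ₁ hΩ₂ H
    obtain ⟨γ₁, ⟨s₁, hs₁, hl₁, hγ₁⟩, e₁⟩ :=
      exists_strongClass_eq_mk (hh₁.exists_isStrongRepresentative hΩ hΩ₁)
    obtain ⟨γ₂, ⟨s₂, hs₂, hl₂, hγ₂⟩, e₂⟩ :=
      exists_strongClass_eq_mk (hh₂.exists_isStrongRepresentative hΩ hΩ₂)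
    rw [e₁, e₂, Submodule.Quotient.eq] at H
    obtain ⟨σ, hσ, hEq⟩ := H
    have hEq' : γ₁.1 - γ₂.1 = coboundary σ := hEq
    rw [← (hα₁.perturb s₁).unique hγ₁, ← (hα₂.perturb s₂).unique hγ₂] at hEq'
    -- Equality of strong classes reads `α₁ + δs₁ = α₂ + δs₂ + δσ`, so `α₁` and `α₂` differ by the
    -- coboundary of `s₂ + σ - s₁`.
    obtain ⟨s, hs, hs', φ, hφ, hφ', hφσ⟩ := exists_conjugacy_of_cohomologous hh₁ hh₂ hα₁ hα₂
      (σ := s₂ + σ - s₁) ((hs₂.add hσ.1).sub hs₁) (by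
        funext T v
        have := congrFun (congrFun hEq' T) v
        simp only [Pi.add_apply, Pi.sub_apply, coboundary] at this ⊢
        rw [sub_eq_iff_eq_add, ← eq_sub_iff_add_eq] at this
        rw [this]
        abel)
    have hl₂' := hl₂.tmove_of_isStronglyPE hσ
    simp only [tmove_tmove] at hl₂'
    -- Thus `φ` intertwines two local maps, a situation symmetric in `φ` and `φ.symm`.
    have hφf : ∀ T, φ (tmove (h₁ T) (s₁ T)) = tmove (h₂ T) (s₂ T + σ T) := by
      intro T
      rw [hφ, hφσ, tmove_tmove]
      simp
    refine ⟨s, hs, hs', φ, ⟨hφ, isLocalMap_of_intertwines hΩ hh₁ hs₁ hl₁ hl₂' hφ hφf, ?_⟩, hφ'⟩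
    refine isLocalMap_of_intertwines hΩ hh₂ (hs₂.add hσ.1) hl₂' hl₁ (φ := φ.symm) ?_ ?_
    · intro S x
      rw [φ.symm_apply_eq, hφ, φ.apply_symm_apply]
    · intro T
      rw [φ.symm_apply_eq]
      exact (hφf T).symm
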